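/- **Notation.** For $a,b\in\mathbb C^k$ let $a\bullet b=\sum_j a_jb_j$ and $|a|=\sqrt{a\bullet\bar a}$. Let $l\ge 1$ and $n,m\ge 2$ be integers, $N=(1,\dots,1,n,m)$ with $l$ ones, $|N|=l+n+m$. Let $\mathbb H_n=\{z\in\mathbb C^{n+1}\setminus\{0\}: z\bullet z=0\}$, $\partial\mathbb M_n=\{z\in\mathbb H_n:|z|=1\}$, $\mathbb H_N=\mathbb C^l\times\mathbb H_n\times\mathbb H_m\subset\mathbb C^{|N|+2}$, let $\mathbb B_N$ be the open Euclidean unit ball of $\mathbb C^{|N|+2}$, $\mathbb M_N=\mathbb H_N\cap\mathbb B_N$, and $\overline{\mathbb M}_N$ its closure. For $i\in\{1,2\}$ let $\mathbb B_{i,|N|}$ be the open ball of radius $i$ about $0$ in $\mathbb C^{|N|}$, and $\mathbb B_{|N|}=\mathbb B_{1,|N|}$. On $\mathbb H_N$, $dV$ is the canonical volume measure of the complex submanifold ($2|N|$-dimensional Hausdorff measure, normalized as Lebesgue measure); on $\mathbb C^{|N|}$, $dV$ is Lebesgue measure. Write points as $Z=(x,z,w),\ \Theta=(\xi,\zeta,\eta)\in\mathbb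 C^l\times\mathbb C^{n+1}\times\mathbb C^{m+1}$ and $\widetilde Z=(\tilde x,\tilde z,\tilde w),\ \widetilde\Theta=(\tilde\xi,\tilde\zeta,\tilde\eta)\in\mathbb C^l\times\mathbb C^n\times\mathbb C^m$. **Charts.** Let $C_0,\delta>0$, $C_1,C_2>1$. Put $\mathcal U_n=\{z\in\mathbb C^{n+1}:\operatorname{dist}(rz,\partial\mathbb M_n)<\delta\text{ for some }r>0\}$ and $\mathcal U(z)=\{\zeta\in\mathbb H_n:|\zeta-z|<|z|/C_1\}$. For each $z\in\mathcal U_n$ choose indices $j<k$ for which there are $r>0$ and $\hat z\in\partial\mathbb M_n$ with $|rz-\hat z|<\delta$ and $|\operatorname{Im}(\hat z_j\overline{\hat z_k})|\ge C_0$ (such indices always exist if $C_0\le\frac1{2(n+1)}$), and let $\Phi^z(\zeta)\in\mathbb C^n$ be obtained from $\zeta\in\mathbb C^{n+1}$ by deleting the coordinate $\zeta_j$, replacing $\zeta_k$ by $\dfrac{\zeta_j\bar z_j+\zeta_k\bar z_k}{\sqrt{|z_j|^2+|z_k|^2}}$, and keeping the other coordinates in their order. Likewise $\mathcal U_m$,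 $\mathcal U(w)$, $\Phi^w$, with the same $C_0,\delta,C_1$. **Comparability.** $Z\in\mathbb B_N$ is *comparable* with $\widetilde Z\in\mathbb C^{|N|}$ if $x=\tilde x$; $\tilde z=\Phi^z(z)$ in case $z\in\mathcal U_n$ and $\mathcal U(z)\neq\varnothing$, and $|\tilde z|=|z|$ otherwise; and the same holds for $w,\tilde w$. For comparable $Z,\widetilde Z$, a point $\zeta\in\mathbb H_n$ is *$i$-comparable* with $\tilde\zeta\in\mathbb C^n$ if (1) $|\zeta|>\sqrt2|z|$ implies $|\tilde\zeta|=|\zeta|$; (2) $|\zeta-z|<|z|/C_1$ implies $\tilde\zeta=\Phi^z(\zeta)$; (3) $|\zeta|\le\sqrt2|z|$ and $|\zeta-z|\ge|z|/C_1$ imply $|\tilde\zeta|\le\sqrt2|\tilde z|$ and $|\tilde\zeta-\tilde z|>|\tilde z|/C_2$ and, if $i=1$, also $|\tilde\zeta|\le|\zeta|$. The same definition is used for $\eta\in\mathbb H_m$, $\tilde\eta\in\mathbb C^m$. Points $\Theta\in\overline{\mathbb M}_N$ and $\widetilde\Theta\in\mathbb C^{|N|}$ are *$i$-comparable* if $\xi=\tilde\xi$,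 $\zeta\in\mathbb H_n$ is $i$-comparable with $\tilde\zeta$, and $\eta\in\mathbb H_m$ is $i$-comparable with $\tilde\eta$. For $K$ on $\overline{\mathbb M}_N$ and $\widetilde K$ on $\overline{\mathbb B}_{i,|N|}$, "$K\lesssim C\widetilde K$ at $(Z,\widetilde Z)$" (respectively "$\widetilde K\lesssim CK$ at $(Z,\widetilde Z)$") means $K(\Theta)\le C\widetilde K(\widetilde\Theta)$ (respectively $\widetilde K(\widetilde\Theta)\le CK(\Theta)$) for all $i$-comparable $\Theta\in\overline{\mathbb M}_N$, $\widetilde\Theta\in\overline{\mathbb B}_{i,|N|}$. **Theorem 5.6 (reduction of estimates).** Let $l,n,m$ be as above and $C_0>0$. There is $\delta_0>0$ such that the following holds. Let $C_1,C_2>1$, $C>0$ and $\alpha=(\alpha_1,\alpha_2,\alpha_3,\alpha_4)$ with $0\le\alpha_1<2n$, $0\le\alpha_2<2m$, $0\le\alpha_3,\alpha_4<2$. Then there is a constant $C_4>0$, depending only on $N,C_0,C_1,C_2,C,\alpha$, such that for every $\delta\in(0,\delta_0)$ with $C_1>\frac1\delta+1$, every choice of the charts $\Phi^z,\Phi^w$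 as above, every $i\in\{1,2\}$, all comparable points $Z\in\mathbb B_N$ and $\widetilde Z\in\mathbb B_{|N|}$, and all measurable $[0,\infty]$-valued functions $K,L$ on $\overline{\mathbb M}_N$ and $\widetilde K,\widetilde L$ on $\overline{\mathbb B}_{i,|N|}$ with $$K\lesssim C\widetilde K,\qquad L\lesssim C\widetilde L,\qquad \widetilde L\lesssim CL\qquad\text{at }(Z,\widetilde Z),$$ the functions $$K_\alpha(\Theta)=K(\Theta)\Bigl(1+\tfrac{|z|}{|\zeta|}\Bigr)^{\alpha_1}\Bigl(1+\tfrac{|w|}{|\eta|}\Bigr)^{\alpha_2}\Bigl|\tfrac{\zeta}{\zeta_{n+1}}\Bigr|^{\alpha_3}\Bigl|\tfrac{\eta}{\eta_{m+1}}\Bigr|^{\alpha_4},$$ $$\widetilde K_{1,\alpha}(\widetilde\Theta)=\widetilde K(\widetilde\Theta)\Bigl(1+\tfrac{|\tilde z|}{|\tilde\zeta|}\Bigr)^{\alpha_1}\Bigl(1+\tfrac{|\tilde w|}{|\tilde\eta|}\Bigr)^{\alpha_2}\Bigl|\tfrac{\tilde\zeta}{\tilde\zeta_n}\Bigr|^{\alpha_3}\Bigl|\tfrac{\tilde\eta}{\tilde\eta_m}\Bigr|^{\alpha_4},\qquad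 \widetilde K_{2,\alpha}(\widetilde\Theta)=\widetilde K(\widetilde\Theta)\Bigl|\tfrac{\tilde\zeta}{\tilde\zeta_n}\Bigr|^{\alpha_3}\Bigl|\tfrac{\tilde\eta}{\tilde\eta_m}\Bigr|^{\alpha_4}$$ satisfy (as integrals with values in $[0,\infty]$) 1) $\displaystyle\int_{\mathbb M_N}K_\alpha\,dV\le C_4\int_{\mathbb B_{i,|N|}}\widetilde K_{i,\alpha}\,dV$; 2) for every $\varepsilon>0$: $\displaystyle\int_{\Theta\in\mathbb M_N,\ L(\Theta)\le\varepsilon}K_\alpha\,dV\le C_4\int_{\widetilde\Theta\in\mathbb B_{i,|N|},\ \widetilde L(\widetilde\Theta)\le C_4\varepsilon}\widetilde K_{i,\alpha}\,dV$; 3) for all $0<\varepsilon_1<\varepsilon_2$: $\displaystyle\int_{\Theta\in\mathbb M_N,\ \varepsilon_1\le L(\Theta)\le\varepsilon_2}K_\alpha\,dV\le C_4\int_{\widetilde\Theta\in\mathbb B_{i,|N|},\ \varepsilon_1/C_4\le\widetilde L(\widetilde\Theta)\le C_4\varepsilon_2}\widetilde K_{i,\alpha}\,dV$. -/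

import Mathlib

open MeasureTheory
open scoped ENNReal ComplexConjugate

noncomputable section

namespace ReductionOfEstimates

/-- `ℂᵏ` with its Euclidean norm. -/
abbrev Cvec (k : ℕ) : Type := EuclideanSpace ℂ (Fin k)

/-- `ℂᵃ × ℂᵇ × ℂᶜ` with the Euclidean norm of `ℂᵃ⁺ᵇ⁺ᶜ`. A point
`Θ = (ξ, ζ, η)` has the components `Θ.fst`, `Θ.snd.fst` and `Θ.snd.snd`. -/
abbrev Triple (a b c : ℕ) : Type := WithLp 2 (Cvec a × WithLp 2 (Cvec b × Cvec c))

/-- The Lebesgue measure of `ℂᵃ⁺ᵇ⁺ᶜ`, as the volume of a Euclidean space. -/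
instance tripleMeasureSpace (a b c : ℕ) : MeasureSpace (Triple a b c) :=
  measureSpaceOfInnerProductSpace

/-! ### The complex manifolds `ℍₙ`, `ℍ_N`, `𝕄_N` and the canonical measure -/

/-- `ℍₙ = {z ∈ ℂⁿ⁺¹ ∖ {0} : z • z = 0}`, where `z • w = ∑ zⱼ wⱼ` is bilinear. -/
def cone (n : ℕ) : Set (Cvec (n + 1)) := {z | z ≠ 0 ∧ ∑ j, z j * z j = 0}

/-- `∂𝕄ₙ`, the intersection of `ℍₙ` with the Euclidean unit sphere. -/
def coneSphere (n : ℕ) : Set (Cvec (n + 1)) := {z | z ∈ cone n ∧ ‖z‖ = 1}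

/-- `ℍ_N = ℂˡ × ℍₙ × ℍₘ`, a complex submanifold of dimension `l + n + m`. -/
def manifoldH (l n m : ℕ) : Set (Triple l (n + 1) (m + 1)) :=
  {Θ | Θ.snd.fst ∈ cone n ∧ Θ.snd.snd ∈ cone m}

/-- `𝕄_N`, the intersection of `ℍ_N` with the open Euclidean unit ball. -/
def manifoldM (l n m : ℕ) : Set (Triple l (n + 1) (m + 1)) :=
  manifoldH l n m ∩ Metric.ball 0 1

/-- The canonical (Riemannian) volume measure `dV` of the submanifold `ℍ_N`: the Hausdorff measure
of real dimension `2 (l + n + m)`, normalized as Lebesgue measure, restricted to `ℍ_N`. -/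
def dV (l n m : ℕ) : Measure (Triple l (n + 1) (m + 1)) :=
  (μHE[2 * (l + n + m)]).restrict (manifoldH l n m)

/-! ### The coordinate charts -/

/-- The open set `𝒰ₙ = {z : dist (r z, ∂𝕄ₙ) < δ for some r > 0}`. -/
def chartDomain (n : ℕ) (δ : ℝ) : Set (Cvec (n + 1)) :=
  {z | ∃ r : ℝ, 0 < r ∧ Metric.infDist (r • z) (coneSphere n) < δ}

/-- The patch `𝒰(z) = {ζ ∈ ℍₙ : |ζ - z| < |z| / C₁}`. -/
def patch {n : ℕ} (C₁ : ℝ) (z : Cvec (n + 1)) : Set (Cvec (n + 1)) :=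
  {ζ | ζ ∈ cone n ∧ ‖ζ - z‖ < ‖z‖ / C₁}

/-- The chart attached to a point `z` and two indices `j < k`: the coordinate `ζⱼ` is deleted, the
coordinate `ζₖ` is replaced by `(ζⱼ z̄ⱼ + ζₖ z̄ₖ) / √(|zⱼ|² + |zₖ|²)`, and the other coordinates are
kept, in their order. -/
def chartMap {n : ℕ} (j k : Fin (n + 1)) (z ζ : Cvec (n + 1)) : Cvec n :=
  WithLp.toLp 2 fun p : Fin n =>
    if j.succAbove p = k then
      (ζ j * conj (z j) + ζ k * conj (z k)) / (Real.sqrt (‖z j‖ ^ 2 + ‖z k‖ ^ 2) : ℂ)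
    else ζ (j.succAbove p)

/-- A choice of the two indices used in the chart at each `z ∈ 𝒰ₙ`: they are indices `j < k` with
`|Im (ẑⱼ conj ẑₖ)| ≥ C₀` at some point `ẑ` of `∂𝕄ₙ` that is `δ`-close to a positive multiple
of `z`. -/
structure ChartChoice (n : ℕ) (C₀ δ : ℝ) where
  /-- the first index -/
  fstIdx : Cvec (n + 1) → Fin (n + 1)
  /-- the second index -/
  sndIdx : Cvec (n + 1) → Fin (n + 1)
  lt_of_mem : ∀ z ∈ chartDomain n δ, fstIdx z < sndIdx z
  close_of_mem : ∀ z ∈ chartDomain n δ, ∃ r : ℝ, 0 < r ∧ ∃ z' ∈ coneSphere n,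
    ‖r • z - z'‖ < δ ∧ C₀ ≤ |(z' (fstIdx z) * conj (z' (sndIdx z))).im|

/-- The chart `Φᶻ`. -/
def ChartChoice.Φ {n : ℕ} {C₀ δ : ℝ} (P : ChartChoice n C₀ δ) (z ζ : Cvec (n + 1)) : Cvec n :=
  chartMap (P.fstIdx z) (P.sndIdx z) z ζ

/-- On `∂𝕄ₙ` one has `max |Im (zⱼ z̄ₖ)| ≥ 1 / (2 (n + 1))`. -/
theorem exists_im_ge {n : ℕ} {C₀ : ℝ} (h0 : 0 < C₀) (hC : C₀ ≤ 1 / (2 * ((n : ℝ) + 1)))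
    {z : Cvec (n + 1)} (hz : z ∈ coneSphere n) :
    ∃ j k : Fin (n + 1), j < k ∧ C₀ ≤ |(z j * conj (z k)).im| := by
  by_contra! hcon
  obtain ⟨⟨hz0, hq⟩, hn⟩ := hz
  have hall : ∀ j k : Fin (n + 1), |(z j * conj (z k)).im| < C₀ := by
    intro j k
    rcases lt_trichotomy j k with h | h | h
    · exact hcon j k h
    · subst h
      rw [Complex.mul_conj]
      simpa using h0
    · have := hcon k j h
      have e : (z j * conj (z k)).im = -(z k * conj (z j)).im := by
        simp [Complex.mul_im]; ring
      rw [e, abs_neg]; exact this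
  have hnorm : ∑ k, z k * conj (z k) = 1 := by
    have : ‖z‖ ^ 2 = ∑ k, ‖z k‖ ^ 2 := EuclideanSpace.norm_sq_eq z
    rw [hn] at this
    simp_rw [Complex.mul_conj']
    exact_mod_cast (by simpa using this.symm)
  have hid : ∀ j, z j = ∑ k, z k * (2 * Complex.I * ((z j * conj (z k)).im : ℂ)) := by
    intro j
    have e : ∀ k, z k * (2 * Complex.I * ((z j * conj (z k)).im : ℂ))
        = z j * (z k * conj (z k)) - conj (z j) * (z k * z k) := by
      intro k
      have : (2 * Complex.I * ((z j * conj (z k)).im : ℂ))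
          = z j * conj (z k) - conj (z j * conj (z k)) := by
        rw [Complex.sub_conj]; push_cast; ring
      rw [this]
      simp only [map_mul, Complex.conj_conj]
      ring
    simp_rw [e]
    rw [Finset.sum_sub_distrib, ← Finset.mul_sum, ← Finset.mul_sum, hnorm, hq]
    ring
  set S := ∑ k, ‖z k‖ with hS
  have hSpos : 0 < S := by
    have : ∃ k, z k ≠ 0 := by
      by_contra! h
      exact hz0 (by ext k; simpa using h k)
    obtain ⟨k, hk⟩ := this
    exact Finset.sum_pos' (fun _ _ => norm_nonneg _) ⟨k, Finset.mem_univ _, norm_pos_iff.2 hk⟩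
  have hj : ∀ j, ‖z j‖ < 2 * C₀ * S := by
    intro j
    have h1 : ‖z j‖ ≤ ∑ k, ‖z k‖ * (2 * |(z j * conj (z k)).im|) := by
      conv_lhs => rw [hid j]
      refine (norm_sum_le _ _).trans (le_of_eq (Finset.sum_congr rfl fun k _ => ?_))
      simp only [norm_mul, Complex.norm_real, Complex.norm_I, Real.norm_eq_abs, RCLike.norm_ofNat,
        mul_one]
    have h2 : ∑ k, ‖z k‖ * (2 * |(z j * conj (z k)).im|) < ∑ k, ‖z k‖ * (2 * C₀) := by
      have : ∃ k, z k ≠ 0 := by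
        by_contra! h
        exact hz0 (by ext k; simpa using h k)
      obtain ⟨k, hk⟩ := this
      refine Finset.sum_lt_sum (fun i _ => ?_) ⟨k, Finset.mem_univ _, ?_⟩
      · exact mul_le_mul_of_nonneg_left (by linarith [hall j i]) (norm_nonneg _)
      · exact mul_lt_mul_of_pos_left (by linarith [hall j k]) (norm_pos_iff.2 hk)
    rw [← Finset.sum_mul] at h2
    linarith
  have hlt : S < ∑ _j : Fin (n + 1), 2 * C₀ * S :=
    Finset.sum_lt_sum_of_nonempty Finset.univ_nonempty fun j _ => hj j
  simp only [Finset.sum_const, Finset.card_univ, Fintype.card_fin, nsmul_eq_mul] at hlt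
  push_cast at hlt
  have hp : (0 : ℝ) < 2 * ((n : ℝ) + 1) := by positivity
  have h3 : C₀ * (2 * ((n : ℝ) + 1)) ≤ 1 := (le_div_iff₀ hp).1 hC
  nlinarith

/-- For `n ≥ 1` the set `∂𝕄ₙ` is non-empty. -/
theorem coneSphere_nonempty {n : ℕ} (hn : 1 ≤ n) : (coneSphere n).Nonempty := by
  set a : Fin (n + 1) := ⟨0, by omega⟩
  set b : Fin (n + 1) := ⟨1, by omega⟩
  have hab : a ≠ b := by simp [a, b]
  let v : Cvec (n + 1) := EuclideanSpace.single a 1 + EuclideanSpace.single b Complex.I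
  have hv : v ≠ 0 := by
    intro h
    have := congrArg (fun u : Cvec (n + 1) => u a) h
    simp [v, hab] at this
  have hq : ∑ j, v j * v j = 0 := by
    rw [Finset.sum_eq_add a b hab]
    · simp [v, hab, hab.symm]
    · intro c _ hc
      simp [v, hc.1, hc.2]
    · simp
    · simp
  refine ⟨((‖v‖⁻¹ : ℝ) : ℂ) • v, ⟨⟨?_, ?_⟩, ?_⟩⟩
  · have := norm_ne_zero_iff.2 hv
    exact smul_ne_zero (by exact_mod_cast inv_ne_zero this) hv
  · have e : ∀ j, (((‖v‖⁻¹ : ℝ) : ℂ) • v) j * (((‖v‖⁻¹ : ℝ) : ℂ) • v) j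
        = ((‖v‖⁻¹ : ℝ) : ℂ) ^ 2 * (v j * v j) := by
      intro j; simp only [PiLp.smul_apply, smul_eq_mul]; ring
    simp_rw [e]
    rw [← Finset.mul_sum, hq, mul_zero]
  · rw [norm_smul]
    simp [norm_ne_zero_iff.2 hv]

/-- Choices of indices, hence charts, exist. -/
theorem chartChoice_nonempty {n : ℕ} (hn : 1 ≤ n) {C₀ δ : ℝ} (h0 : 0 < C₀)
    (hC : C₀ ≤ 1 / (2 * ((n : ℝ) + 1))) : Nonempty (ChartChoice n C₀ δ) := by
  have key : ∀ z : Cvec (n + 1), ∃ p : Fin (n + 1) × Fin (n + 1), z ∈ chartDomain n δ →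
      p.1 < p.2 ∧ ∃ r : ℝ, 0 < r ∧ ∃ z' ∈ coneSphere n,
        ‖r • z - z'‖ < δ ∧ C₀ ≤ |(z' p.1 * conj (z' p.2)).im| := by
    intro z
    by_cases hz : z ∈ chartDomain n δ
    · obtain ⟨r, hr, hd⟩ := hz
      obtain ⟨z', hz', hlt⟩ := (Metric.infDist_lt_iff (coneSphere_nonempty hn)).1 hd
      obtain ⟨j, k, hjk, him⟩ := exists_im_ge h0 hC hz'
      exact ⟨(j, k), fun _ => ⟨hjk, r, hr, z', hz', by rwa [← dist_eq_norm], him⟩⟩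
    · exact ⟨(0, 0), fun h => absurd h hz⟩
  choose p hp using key
  exact ⟨⟨fun z => (p z).1, fun z => (p z).2, fun z hz => (hp z hz).1, fun z hz => (hp z hz).2⟩⟩

/-! ### Comparability -/

/-- Conditions (2) and (3) of comparability of `Z` with `Z̃`, for one component. -/
def CompBase {n : ℕ} {C₀ δ : ℝ} (P : ChartChoice n C₀ δ) (C₁ : ℝ)
    (z : Cvec (n + 1)) (z' : Cvec n) : Prop :=
  ((z ∈ chartDomain n δ ∧ (patch C₁ z).Nonempty) → z' = P.Φ z z) ∧
  (¬(z ∈ chartDomain n δ ∧ (patch C₁ z).Nonempty) → ‖z'‖ = ‖z‖)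

/-- `Z = (x, z, w)` is comparable with `Z̃ = (x̃, z̃, w̃)`. -/
def Comparable {l n m : ℕ} {C₀ δ : ℝ} (P : ChartChoice n C₀ δ) (Q : ChartChoice m C₀ δ) (C₁ : ℝ)
    (Z : Triple l (n + 1) (m + 1)) (Z' : Triple l n m) : Prop :=
  Z.fst = Z'.fst ∧ CompBase P C₁ Z.snd.fst Z'.snd.fst ∧ CompBase Q C₁ Z.snd.snd Z'.snd.snd

/-- `ζ ∈ ℍₙ` is `i`-comparable with `ζ̃ ∈ ℂⁿ`, relative to the components `z` and `z̃` of two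
comparable points. -/
def CompPoint {n : ℕ} {C₀ δ : ℝ} (P : ChartChoice n C₀ δ) (C₁ C₂ : ℝ) (i : ℕ)
    (z : Cvec (n + 1)) (z' : Cvec n) (ζ : Cvec (n + 1)) (ζ' : Cvec n) : Prop :=
  ζ ∈ cone n ∧
  (‖ζ‖ > Real.sqrt 2 * ‖z‖ → ‖ζ'‖ = ‖ζ‖) ∧
  (‖ζ - z‖ < ‖z‖ / C₁ → ζ' = P.Φ z ζ) ∧
  (‖ζ‖ ≤ Real.sqrt 2 * ‖z‖ ∧ ‖ζ - z‖ ≥ ‖z‖ / C₁ →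
    ‖ζ'‖ ≤ Real.sqrt 2 * ‖z'‖ ∧ ‖ζ' - z'‖ > ‖z'‖ / C₂ ∧ (i = 1 → ‖ζ'‖ ≤ ‖ζ‖))

/-- `Θ = (ξ, ζ, η)` and `Θ̃ = (ξ̃, ζ̃, η̃)` are `i`-comparable, relative to `(Z, Z̃)`. -/
def IComparable {l n m : ℕ} {C₀ δ : ℝ} (P : ChartChoice n C₀ δ) (Q : ChartChoice m C₀ δ)
    (C₁ C₂ : ℝ) (i : ℕ) (Z : Triple l (n + 1) (m + 1)) (Z' : Triple l n m)
    (Θ : Triple l (n + 1) (m + 1)) (Θ' : Triple l n m) : Prop :=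
  Θ.fst = Θ'.fst ∧
  CompPoint P C₁ C₂ i Z.snd.fst Z'.snd.fst Θ.snd.fst Θ'.snd.fst ∧
  CompPoint Q C₁ C₂ i Z.snd.snd Z'.snd.snd Θ.snd.snd Θ'.snd.snd

/-- `K ≲ C K̃` at `(Z, Z̃)`. -/
def LesssimLeft {l n m : ℕ} {C₀ δ : ℝ} (P : ChartChoice n C₀ δ) (Q : ChartChoice m C₀ δ)
    (C₁ C₂ : ℝ) (i : ℕ) (Z : Triple l (n + 1) (m + 1)) (Z' : Triple l n m) (C : ℝ)
    (K : Triple l (n + 1) (m + 1) → ℝ≥0∞) (K' : Triple l n m → ℝ≥0∞) : Prop :=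
  ∀ Θ ∈ closure (manifoldM l n m), ∀ Θ' ∈ Metric.closedBall (0 : Triple l n m) (i : ℝ),
    IComparable P Q C₁ C₂ i Z Z' Θ Θ' → K Θ ≤ ENNReal.ofReal C * K' Θ'

/-- `K̃ ≲ C K` at `(Z, Z̃)`. -/
def LesssimRight {l n m : ℕ} {C₀ δ : ℝ} (P : ChartChoice n C₀ δ) (Q : ChartChoice m C₀ δ)
    (C₁ C₂ : ℝ) (i : ℕ) (Z : Triple l (n + 1) (m + 1)) (Z' : Triple l n m) (C : ℝ)
    (K : Triple l (n + 1) (m + 1) → ℝ≥0∞) (K' : Triple l n m → ℝ≥0∞) : Prop :=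
  ∀ Θ ∈ closure (manifoldM l n m), ∀ Θ' ∈ Metric.closedBall (0 : Triple l n m) (i : ℝ),
    IComparable P Q C₁ C₂ i Z Z' Θ Θ' → K' Θ' ≤ ENNReal.ofReal C * K Θ

/-! ### The weights -/

/-- The last coordinate of a vector of `ℂᵏ` (for `k ≥ 1`). -/
def lastCoord {k : ℕ} (v : Cvec k) : ℂ := if h : 0 < k then v ⟨k - 1, by omega⟩ else 0

/-- `(1 + |z| / |ζ|)^α₁ (1 + |w| / |η|)^α₂`. -/
def radialWeight {a b c : ℕ} (α : Fin 4 → ℝ) (Z Θ : Triple a b c) : ℝ≥0∞ :=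
  (1 + ‖Z.snd.fst‖ₑ / ‖Θ.snd.fst‖ₑ) ^ α 0 * (1 + ‖Z.snd.snd‖ₑ / ‖Θ.snd.snd‖ₑ) ^ α 1

/-- `|ζ / ζ_last|^α₃ |η / η_last|^α₄`, with value `∞` where a denominator vanishes and the exponent
is positive. -/
def angularWeight {a b c : ℕ} (α : Fin 4 → ℝ) (Θ : Triple a b c) : ℝ≥0∞ :=
  (‖Θ.snd.fst‖ₑ / ‖lastCoord Θ.snd.fst‖ₑ) ^ α 2 * (‖Θ.snd.snd‖ₑ / ‖lastCoord Θ.snd.snd‖ₑ) ^ α 3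

/-- `K_α`. -/
def weighted {l n m : ℕ} (α : Fin 4 → ℝ) (Z : Triple l (n + 1) (m + 1))
    (K : Triple l (n + 1) (m + 1) → ℝ≥0∞) (Θ : Triple l (n + 1) (m + 1)) : ℝ≥0∞ :=
  K Θ * (radialWeight α Z Θ * angularWeight α Θ)

/-- `K̃_{i,α}`: both weights for `i = 1`, only the second one for `i = 2`. -/
def weightedTilde {l n m : ℕ} (i : ℕ) (α : Fin 4 → ℝ) (Z' : Triple l n m)
    (K' : Triple l n m → ℝ≥0∞) (Θ' : Triple l n m) : ℝ≥0∞ :=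
  if i = 1 then K' Θ' * (radialWeight α Z' Θ' * angularWeight α Θ')
  else K' Θ' * angularWeight α Θ'

end ReductionOfEstimates

end

open ReductionOfEstimates

noncomputable section

namespace ReductionOfEstimates

open scoped Pointwise

/-! ### Hausdorff measures under expanding maps, and comparison of homogeneous measures -/

section Hausdorff

variable {X Y : Type*} [MetricSpace X] [MeasurableSpace X] [BorelSpace X]
  [MetricSpace Y] [MeasurableSpace Y] [BorelSpace Y]

theorem euclideanHausdorffMeasure_image_le {d : ℕ} {K : NNReal} {f : X → Y} {s : Set X}
    (h : LipschitzOnWith K f s) :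
    (μHE[d] : Measure Y) (f '' s) ≤ (K : ℝ≥0∞) ^ d * (μHE[d] : Measure X) s := by
  rw [Measure.euclideanHausdorffMeasure_def, Measure.euclideanHausdorffMeasure_def,
    Measure.smul_apply, Measure.smul_apply, ENNReal.smul_def, ENNReal.smul_def,
    smul_eq_mul, smul_eq_mul, mul_left_comm]
  have := h.hausdorffMeasure_image_le (d := (d : ℝ)) (by positivity)
  rw [ENNReal.rpow_natCast] at this
  gcongr

theorem euclideanHausdorffMeasure_le_image {d : ℕ} {K : NNReal} {f : X → Y} {s : Set X}
    (h : ∀ x ∈ s, ∀ y ∈ s, dist x y ≤ K * dist (f x) (f y)) :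
    (μHE[d] : Measure X) s ≤ (K : ℝ≥0∞) ^ d * (μHE[d] : Measure Y) (f '' s) := by
  rcases s.eq_empty_or_nonempty with rfl | ⟨x₀, hx₀⟩
  · simp
  have : Nonempty X := ⟨x₀⟩
  have hinj : Set.InjOn f s := by
    intro x hx y hy hxy
    have := h x hx y hy
    rw [hxy, dist_self, mul_zero] at this
    exact dist_le_zero.1 this
  have hg : LipschitzOnWith K (Function.invFunOn f s) (f '' s) := by
    refine LipschitzOnWith.of_dist_le_mul ?_
    rintro _ ⟨x, hx, rfl⟩ _ ⟨y, hy, rfl⟩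
    rw [hinj.leftInvOn_invFunOn hx, hinj.leftInvOn_invFunOn hy]
    exact h x hx y hy
  have := euclideanHausdorffMeasure_image_le (d := d) hg
  rwa [hinj.invFunOn_image subset_rfl] at this

end Hausdorff

section Homogeneous

variable {E E' : Type*} [NormedAddCommGroup E] [NormedSpace ℝ E] [MeasurableSpace E] [BorelSpace E]
  [NormedAddCommGroup E'] [NormedSpace ℝ E'] [MeasurableSpace E'] [BorelSpace E']

/-- The measure `μ` scales with the power `d` under dilations. -/
def HomogeneousMeasure (μ : Measure E) (d : ℕ) : Prop :=
  ∀ r : ℝ, 0 < r → ∀ f : E → ℝ≥0∞, Measurable f →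
    ∫⁻ x, f x ∂μ = ENNReal.ofReal r ^ d * ∫⁻ x, f (r • x) ∂μ

theorem homogeneousMeasure_of_preimage {μ : Measure E} {d : ℕ}
    (h : ∀ r : ℝ, 0 < r → ∀ s, MeasurableSet s →
      μ s = ENNReal.ofReal r ^ d * μ ((fun x => r • x) ⁻¹' s)) : HomogeneousMeasure μ d := by
  intro r hr f hf
  have hm : Measurable (fun x : E => r • x) := (continuous_const_smul r).measurable
  have : μ = ENNReal.ofReal r ^ d • μ.map (fun x => r • x) := by
    ext s hs
    rw [Measure.smul_apply, Measure.map_apply hm hs, smul_eq_mul]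
    exact h r hr s hs
  conv_lhs => rw [this]
  rw [lintegral_smul_measure, lintegral_map hf hm, smul_eq_mul]

theorem homogeneousMeasure_addHaar [FiniteDimensional ℝ E] (μ : Measure E) [μ.IsAddHaarMeasure] :
    HomogeneousMeasure μ (Module.finrank ℝ E) := by
  refine homogeneousMeasure_of_preimage fun r hr s _ => ?_
  rw [Measure.addHaar_preimage_smul μ hr.ne', ← mul_assoc, ← ENNReal.ofReal_pow hr.le,
    ← ENNReal.ofReal_mul (by positivity), abs_of_pos (by positivity), mul_inv_cancel₀ (by positivity)]
  simp

variable {μ : Measure E} {ν : Measure E'} [SFinite μ] [SFinite ν]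
  {d : ℕ} {Ω f : E → ℝ≥0∞} {g : E' → ℝ≥0∞}

theorem lintegral_mul_le_of_norm_eq_of_homogeneous [SecondCountableTopology E]
    [SecondCountableTopology E'] (hμ : HomogeneousMeasure μ d)
    (hν : HomogeneousMeasure ν d) (hΩ : Measurable Ω) (hf : Measurable f) (hg : Measurable g)
    (hΩr : ∀ r : ℝ, 0 < r → ∀ x, Ω (r • x) = Ω x) (hf0 : f 0 = 0)
    (hfg : ∀ x y, ‖x‖ = ‖y‖ → f x ≤ g y) :
    ν {u | ‖u‖ ≤ 1 ∧ 1 ≤ 2 * ‖u‖} * ∫⁻ x, f x * Ω x ∂μ ≤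
      (∫⁻ x in {x | 1 ≤ ‖x‖ ∧ ‖x‖ ≤ 2}, Ω x ∂μ) * ∫⁻ y, g y ∂ν := by
  set A : Set E := {x | 1 ≤ ‖x‖ ∧ ‖x‖ ≤ 2} with hA
  have hAm : MeasurableSet A :=
    (measurableSet_le measurable_const measurable_norm).inter
      (measurableSet_le measurable_norm measurable_const)
  set R : Set (E × E') := {p | ‖p.2‖ ≤ ‖p.1‖ ∧ ‖p.1‖ ≤ 2 * ‖p.2‖} with hR
  have hRm : MeasurableSet R :=
    (measurableSet_le (f := fun p : E × E' => ‖p.2‖) (g := fun p => ‖p.1‖)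
      (by fun_prop) (by fun_prop)).inter
      (measurableSet_le (f := fun p : E × E' => ‖p.1‖) (g := fun p => 2 * ‖p.2‖)
        (by fun_prop) (by fun_prop))
  have hfm : Measurable fun p : E × E' => f (‖p.2‖ • p.1) := hf.comp (by fun_prop)
  set I : ℝ≥0∞ := ∫⁻ y, ∫⁻ x in A, Ω x * f (‖y‖ • x) ∂μ ∂ν with hI
  -- upper bound
  have hup : I ≤ (∫⁻ x in A, Ω x ∂μ) * ∫⁻ y, g y ∂ν := by
    rw [hI, lintegral_lintegral_swap (by
      exact ((hΩ.comp measurable_snd).mul (hfm.comp measurable_swap)).aemeasurable),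
      ← lintegral_mul_const _ hΩ]
    refine setLIntegral_mono' hAm fun x hx => ?_
    rw [lintegral_const_mul (f := fun y : E' => f (‖y‖ • x)) _ (hfm.comp measurable_prodMk_left)]
    refine mul_le_mul' le_rfl ?_
    have hx0 : 0 < ‖x‖ := by linarith [hx.1]
    calc ∫⁻ y, f (‖y‖ • x) ∂ν ≤ ∫⁻ y, g (‖x‖ • y) ∂ν :=
          lintegral_mono fun y => hfg _ _ (by simp [norm_smul, mul_comm])
      _ ≤ ENNReal.ofReal ‖x‖ ^ d * ∫⁻ y, g (‖x‖ • y) ∂ν := by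
          refine le_mul_of_one_le_left zero_le (one_le_pow₀ ?_)
          exact ENNReal.one_le_ofReal.2 hx.1
      _ = _ := (hν _ hx0 g hg).symm
  -- lower bound
  have hlow : ∫⁻ y, ∫⁻ x, (ENNReal.ofReal ‖y‖ ^ d)⁻¹ * R.indicator (fun p => f p.1 * Ω p.1) (x, y)
      ∂μ ∂ν ≤ I := by
    refine lintegral_mono fun y => ?_
    have hm : Measurable fun x => R.indicator (fun p => f p.1 * Ω p.1) (x, y) :=
      (((hf.comp measurable_fst).mul (hΩ.comp measurable_fst)).indicator hRm).comp
        (by fun_prop)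
    rw [lintegral_const_mul _ hm]
    rcases eq_or_ne y 0 with rfl | hy
    · have : (fun x => R.indicator (fun p => f p.1 * Ω p.1) (x, (0 : E'))) = fun _ => 0 := by
        funext x
        refine Set.indicator_apply_eq_zero.2 fun hx => ?_
        have h0 : x = 0 := by simpa using hx.2
        simp [h0, hf0]
      simp [this]
    · have hy0 : 0 < ‖y‖ := norm_pos_iff.2 hy
      rw [hμ _ hy0 _ hm, ← mul_assoc, ENNReal.inv_mul_cancel
        (pow_ne_zero _ (by simpa using hy)) (ENNReal.pow_ne_top ENNReal.ofReal_ne_top), one_mul,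
        ← lintegral_indicator hAm]
      refine lintegral_mono fun x => ?_
      by_cases hx : x ∈ A
      · rw [Set.indicator_of_mem hx]
        refine (Set.indicator_le_self _ _ _).trans ?_
        simp only [hΩr _ hy0]
        rw [mul_comm]
      · rw [Set.indicator_of_notMem, Set.indicator_of_notMem hx]
        rintro ⟨h1, h2⟩
        simp only [norm_smul, norm_norm] at h1 h2
        exact hx ⟨by nlinarith, by nlinarith⟩
  rw [lintegral_lintegral_swap] at hlow
  swap
  · refine Measurable.aemeasurable (Measurable.mul ?_ ?_)
    · exact ((ENNReal.measurable_ofReal.comp (by fun_prop)).pow_const d).inv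
    · exact (((hf.comp measurable_fst).mul (hΩ.comp measurable_fst)).indicator hRm).comp
        measurable_swap
  refine le_trans ?_ (hlow.trans hup)
  rw [← lintegral_const_mul (f := fun x => f x * Ω x) _ (hf.mul hΩ)]
  refine lintegral_mono fun x => ?_
  rcases eq_or_ne x 0 with rfl | hx
  · simp [hf0]
  have hx0 : 0 < ‖x‖ := norm_pos_iff.2 hx
  have hBm : MeasurableSet {u : E' | ‖u‖ ≤ 1 ∧ 1 ≤ 2 * ‖u‖} :=
    (measurableSet_le measurable_norm measurable_const).inter
      (measurableSet_le (g := fun u : E' => 2 * ‖u‖) measurable_const (by fun_prop))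
  have hm : Measurable fun y => (ENNReal.ofReal ‖y‖ ^ d)⁻¹ *
      R.indicator (fun p => f p.1 * Ω p.1) (x, y) := by
    refine Measurable.mul (by fun_prop) ?_
    exact (((hf.comp measurable_fst).mul (hΩ.comp measurable_fst)).indicator hRm).comp
      (by fun_prop)
  have hm' := hm.comp (continuous_const_smul ‖x‖ : Continuous fun u : E' => ‖x‖ • u).measurable
  rw [Function.comp_def] at hm'
  rw [hν _ hx0 _ hm, ← lintegral_const_mul _ hm', ← lintegral_indicator_one hBm,
    ← lintegral_mul_const _ (measurable_one.indicator hBm)]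
  refine lintegral_mono fun u => ?_
  by_cases hu : u ∈ {u : E' | ‖u‖ ≤ 1 ∧ 1 ≤ 2 * ‖u‖}
  · have hR' : (x, ‖x‖ • u) ∈ R := by
      refine ⟨?_, ?_⟩
      · simp only [norm_smul, norm_norm]; nlinarith [hu.1]
      · simp only [norm_smul, norm_norm]; nlinarith [hu.2]
    rw [Set.indicator_of_mem hu, Set.indicator_of_mem hR', Pi.one_apply, one_mul, ← mul_assoc]
    refine le_mul_of_one_le_left zero_le ?_
    rw [norm_smul, norm_norm, ← div_eq_mul_inv]
    refine (ENNReal.le_div_iff_mul_le ?_ ?_).2 ?_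
    · left
      have : 0 < ‖u‖ := by linarith [hu.2]
      exact pow_ne_zero _ (ENNReal.ofReal_pos.2 (by positivity)).ne'
    · left; exact ENNReal.pow_ne_top ENNReal.ofReal_ne_top
    · rw [one_mul]
      gcongr
      nlinarith [hu.1]
  · rw [Set.indicator_of_notMem hu]; simp

end Homogeneous

/-! ### The chart maps -/

section Chart

variable {n : ℕ}

theorem chartMap_sub (j k : Fin (n + 1)) (z ζ η : Cvec (n + 1)) :
    chartMap j k z (ζ - η) = chartMap j k z ζ - chartMap j k z η := by
  ext p
  simp only [chartMap, PiLp.sub_apply]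
  split_ifs <;> ring

theorem chartMap_smul (j k : Fin (n + 1)) (z ζ : Cvec (n + 1)) (r : ℝ) :
    chartMap j k z (r • ζ) = r • chartMap j k z ζ := by
  ext p
  simp only [chartMap, PiLp.smul_apply, Complex.real_smul]
  split_ifs
  · ring
  · rfl

theorem chartMap_smul_base (j k : Fin (n + 1)) (z ζ : Cvec (n + 1)) {r : ℝ} (hr : 0 < r) :
    chartMap j k (r • z) ζ = chartMap j k z ζ := by
  ext p
  simp only [chartMap, PiLp.smul_apply, Complex.real_smul, norm_mul, Complex.norm_real,
    Real.norm_eq_abs, abs_of_pos hr, map_mul, Complex.conj_ofReal]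
  split_ifs
  · rw [show (r * ‖z j‖) ^ 2 + (r * ‖z k‖) ^ 2 = r ^ 2 * (‖z j‖ ^ 2 + ‖z k‖ ^ 2) by ring,
      Real.sqrt_mul (by positivity), Real.sqrt_sq hr.le, Complex.ofReal_mul,
      ← mul_div_mul_left (ζ j * conj (z j) + ζ k * conj (z k)) _
        (Complex.ofReal_ne_zero.2 hr.ne' : (r : ℂ) ≠ 0)]
    congr 1
    ring
  · rfl

theorem continuous_chartMap (j k : Fin (n + 1)) (z : Cvec (n + 1)) :
    Continuous (chartMap j k z) := by
  refine (PiLp.continuous_toLp 2 _).comp (continuous_pi fun p => ?_)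
  split_ifs <;> fun_prop

/-- The chart changes the norm only through the coordinate that carries the combination of `ζⱼ`
and `ζₖ`. -/
theorem norm_sq_chartMap {j k : Fin (n + 1)} {p₀ : Fin n} (hp : j.succAbove p₀ = k)
    (z ζ : Cvec (n + 1)) :
    ‖chartMap j k z ζ‖ ^ 2 + ‖ζ j‖ ^ 2 + ‖ζ k‖ ^ 2 =
      ‖ζ‖ ^ 2 + ‖chartMap j k z ζ p₀‖ ^ 2 := by
  rw [EuclideanSpace.norm_sq_eq, EuclideanSpace.norm_sq_eq, Fin.sum_univ_succAbove _ j,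
    ← Finset.add_sum_erase _ _ (Finset.mem_univ p₀),
    ← Finset.add_sum_erase _ (fun i => ‖ζ (j.succAbove i)‖ ^ 2) (Finset.mem_univ p₀), hp]
  have : ∀ p ∈ Finset.univ.erase p₀, ‖chartMap j k z ζ p‖ ^ 2 = ‖ζ (j.succAbove p)‖ ^ 2 := by
    intro p hpe
    have : j.succAbove p ≠ k := fun h =>
      (Finset.ne_of_mem_erase hpe) (Fin.succAbove_right_injective (h.trans hp.symm))
    simp [chartMap, this]
  rw [Finset.sum_congr rfl this]
  ring

theorem chartMap_apply_eq {j k : Fin (n + 1)} {p₀ : Fin n} (hp : j.succAbove p₀ = k)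
    (z ζ : Cvec (n + 1)) : chartMap j k z ζ p₀ =
      (ζ j * conj (z j) + ζ k * conj (z k)) / (Real.sqrt (‖z j‖ ^ 2 + ‖z k‖ ^ 2) : ℂ) := by
  simp [chartMap, hp]

theorem norm_chartMap_le {j k : Fin (n + 1)} (hjk : j ≠ k) (z ζ : Cvec (n + 1)) :
    ‖chartMap j k z ζ‖ ≤ ‖ζ‖ := by
  obtain ⟨p₀, hp⟩ := Fin.exists_succAbove_eq hjk.symm
  have h := norm_sq_chartMap hp z ζ
  suffices ‖chartMap j k z ζ p₀‖ ^ 2 ≤ ‖ζ j‖ ^ 2 + ‖ζ k‖ ^ 2 from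
    (sq_le_sq₀ (norm_nonneg _) (norm_nonneg _)).1 (by linarith)
  rw [chartMap_apply_eq hp, norm_div, div_pow, Complex.norm_real, Real.norm_eq_abs, sq_abs,
    Real.sq_sqrt (by positivity)]
  refine div_le_of_le_mul₀ (by positivity) (by positivity) ?_
  have h1 : ‖ζ j * conj (z j) + ζ k * conj (z k)‖ ≤ ‖ζ j‖ * ‖z j‖ + ‖ζ k‖ * ‖z k‖ := by
    refine (norm_add_le _ _).trans_eq ?_
    simp
  have h2 : ‖ζ j * conj (z j) + ζ k * conj (z k)‖ ^ 2 ≤ (‖ζ j‖ * ‖z j‖ + ‖ζ k‖ * ‖z k‖) ^ 2 := by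
    gcongr
  nlinarith [sq_nonneg (‖ζ j‖ * ‖z k‖ - ‖ζ k‖ * ‖z j‖)]

theorem norm_chartMap_self {j k : Fin (n + 1)} (hjk : j ≠ k) (z : Cvec (n + 1)) :
    ‖chartMap j k z z‖ = ‖z‖ := by
  obtain ⟨p₀, hp⟩ := Fin.exists_succAbove_eq hjk.symm
  have h := norm_sq_chartMap hp z z
  suffices ‖chartMap j k z z p₀‖ ^ 2 = ‖z j‖ ^ 2 + ‖z k‖ ^ 2 from
    (sq_eq_sq₀ (norm_nonneg _) (norm_nonneg _)).1 (by linarith)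
  rw [chartMap_apply_eq hp, Complex.mul_conj', Complex.mul_conj', norm_div, div_pow,
    Complex.norm_real, Real.norm_eq_abs, sq_abs, Real.sq_sqrt (by positivity)]
  rw [show ((‖z j‖ : ℂ) ^ 2 + (‖z k‖ : ℂ) ^ 2) = ((‖z j‖ ^ 2 + ‖z k‖ ^ 2 : ℝ) : ℂ) by push_cast; rfl,
    Complex.norm_real, Real.norm_eq_abs, abs_of_nonneg (by positivity)]
  rcases eq_or_ne (‖z j‖ ^ 2 + ‖z k‖ ^ 2) 0 with h0 | h0
  · simp [h0]
  · field_simp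

theorem norm_le_of_det {n : ℕ} {j k : Fin (n + 1)} (hjk : j ≠ k) {c M : ℝ} (hc : 0 < c)
    {z s D : Cvec (n + 1)} (hz : ‖z‖ ≤ M) (hs : ‖s‖ ≤ M) (hsD : ∑ i, D i * s i = 0)
    (hdet : c ≤ ‖s j * conj (z k) - s k * conj (z j)‖) :
    ‖D‖ ≤ (n + 2 * (M ^ 2 * (n + 2) / c)) * ‖chartMap j k z D‖ := by
  obtain ⟨p₀, hp⟩ := Fin.exists_succAbove_eq hjk.symm
  have hM : 0 ≤ M := (norm_nonneg _).trans hz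
  set N := ‖chartMap j k z D‖ with hN
  have hN0 : 0 ≤ N := norm_nonneg _
  have hzi : ∀ i, ‖z i‖ ≤ M := fun i => (PiLp.norm_apply_le z i).trans hz
  have hsi : ∀ i, ‖s i‖ ≤ M := fun i => (PiLp.norm_apply_le s i).trans hs
  have hoth : ∀ p ∈ Finset.univ.erase p₀, ‖D (j.succAbove p)‖ ≤ N := by
    intro p hpe
    have : j.succAbove p ≠ k := fun h =>
      (Finset.ne_of_mem_erase hpe) (Fin.succAbove_right_injective (h.trans hp.symm))
    have e : chartMap j k z D p = D (j.succAbove p) := by simp [chartMap, this]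
    rw [← e]; exact PiLp.norm_apply_le _ p
  have hcard : ((Finset.univ.erase p₀).card : ℝ) ≤ n := by
    have := Finset.card_erase_le (s := (Finset.univ : Finset (Fin n))) (a := p₀)
    simp only [Finset.card_univ, Fintype.card_fin] at this
    exact_mod_cast this
  have h1 : ‖D j * s j + D k * s k‖ ≤ n * (M * N) := by
    rw [Fin.sum_univ_succAbove _ j, ← Finset.add_sum_erase _ _ (Finset.mem_univ p₀), hp,
      ← add_assoc] at hsD
    rw [eq_neg_of_add_eq_zero_left hsD, norm_neg]
    refine (norm_sum_le_of_le _ (f := fun _ => _) (n := fun _ => M * N) fun p hpe => ?_).trans ?_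
    · rw [norm_mul, mul_comm]
      exact mul_le_mul (hsi _) (hoth p hpe) (norm_nonneg _) hM
    · rw [Finset.sum_const, nsmul_eq_mul]
      gcongr
  have h2 : ‖D j * conj (z j) + D k * conj (z k)‖ ≤ 2 * M * N := by
    set ρ := Real.sqrt (‖z j‖ ^ 2 + ‖z k‖ ^ 2) with hρ
    have hρ2 : ρ ≤ 2 * M := by
      refine Real.sqrt_le_iff.2 ⟨by positivity, ?_⟩
      nlinarith [hzi j, hzi k, norm_nonneg (z j), norm_nonneg (z k)]
    have hρ0 : ρ ≠ 0 := by
      intro h0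
      have h3 : ‖z j‖ ^ 2 + ‖z k‖ ^ 2 = 0 := by
        have := (Real.sqrt_eq_zero (by positivity)).1 h0
        exact this
      have hj : z j = 0 := by
        have : ‖z j‖ ^ 2 = 0 := by nlinarith [sq_nonneg ‖z j‖, sq_nonneg ‖z k‖]
        simpa using this
      have hk : z k = 0 := by
        have : ‖z k‖ ^ 2 = 0 := by nlinarith [sq_nonneg ‖z j‖, sq_nonneg ‖z k‖]
        simpa using this
      rw [hj, hk] at hdet
      simp at hdet
      linarith
    have e : D j * conj (z j) + D k * conj (z k) = chartMap j k z D p₀ * ρ := by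
      rw [chartMap_apply_eq hp, div_mul_cancel₀]
      exact Complex.ofReal_ne_zero.2 hρ0
    rw [e, norm_mul, Complex.norm_real, Real.norm_eq_abs, abs_of_nonneg (Real.sqrt_nonneg _),
      mul_comm]
    exact mul_le_mul hρ2 (PiLp.norm_apply_le _ _) (norm_nonneg _) (by positivity)
  have hDj : ‖D j‖ ≤ M ^ 2 * (n + 2) / c * N := by
    have e : (s j * conj (z k) - s k * conj (z j)) * D j =
        conj (z k) * (D j * s j + D k * s k) - s k * (D j * conj (z j) + D k * conj (z k)) := by
      ring
    have h3 : c * ‖D j‖ ≤ M * (n * (M * N)) + M * (2 * M * N) := by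
      calc c * ‖D j‖ ≤ ‖(s j * conj (z k) - s k * conj (z j)) * D j‖ := by
            rw [norm_mul]; gcongr
        _ ≤ _ := by
            rw [e]
            refine (norm_sub_le _ _).trans ?_
            rw [norm_mul, norm_mul, RCLike.norm_conj]
            gcongr <;> first | exact hzi _ | exact hsi _
    rw [div_mul_eq_mul_div, le_div_iff₀ hc]
    linarith
  have hDk : ‖D k‖ ≤ M ^ 2 * (n + 2) / c * N := by
    have e : (s j * conj (z k) - s k * conj (z j)) * D k =
        s j * (D j * conj (z j) + D k * conj (z k)) - conj (z j) * (D j * s j + D k * s k) := by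
      ring
    have h3 : c * ‖D k‖ ≤ M * (2 * M * N) + M * (n * (M * N)) := by
      calc c * ‖D k‖ ≤ ‖(s j * conj (z k) - s k * conj (z j)) * D k‖ := by
            rw [norm_mul]; gcongr
        _ ≤ _ := by
            rw [e]
            refine (norm_sub_le _ _).trans ?_
            rw [norm_mul, norm_mul, RCLike.norm_conj]
            gcongr <;> first | exact hzi _ | exact hsi _
    rw [div_mul_eq_mul_div, le_div_iff₀ hc]
    linarith
  have hsum : ‖D‖ ≤ ∑ i, ‖D i‖ := by
    rw [EuclideanSpace.norm_eq]
    refine Real.sqrt_le_iff.2 ⟨Finset.sum_nonneg fun _ _ => norm_nonneg _, ?_⟩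
    exact Finset.sum_sq_le_sq_sum_of_nonneg fun _ _ => norm_nonneg _
  rw [Fin.sum_univ_succAbove _ j, ← Finset.add_sum_erase _ _ (Finset.mem_univ p₀), hp] at hsum
  have hrest : ∑ p ∈ Finset.univ.erase p₀, ‖D (j.succAbove p)‖ ≤ n * N := by
    refine (Finset.sum_le_card_nsmul _ _ N hoth).trans ?_
    rw [nsmul_eq_mul]; gcongr
  linarith

/-- The pair `j, k` is admissible for a chart at `z`: up to a positive factor `z` is `δ`-close to
a unit vector `ẑ` with `|Im (ẑⱼ conj ẑₖ)| ≥ c`. -/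
def Admissible (c δ : ℝ) (j k : Fin (n + 1)) (z : Cvec (n + 1)) : Prop :=
  ∃ r : ℝ, 0 < r ∧ ∃ u : Cvec (n + 1), ‖u‖ = 1 ∧ ‖r • z - u‖ < δ ∧ c ≤ |(u j * conj (u k)).im|

theorem norm_sub_le_of_admissible {c δ : ℝ} (hc : 0 < c) (hδc : 18 * δ ≤ c)
    (hδ1 : δ ≤ 1 / 3) {j k : Fin (n + 1)} (hjk : j ≠ k) {z ζ η : Cvec (n + 1)}
    (hz : Admissible c δ j k z) (hζ : ζ ∈ cone n) (hη : η ∈ cone n)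
    (hζz : ‖ζ - z‖ < δ * ‖z‖) (hηz : ‖η - z‖ < δ * ‖z‖) :
    ‖ζ - η‖ ≤ (n + 2 * (16 * (n + 2) / (2 * c))) * ‖chartMap j k z ζ - chartMap j k z η‖ := by
  obtain ⟨r, hr, u, hu, hzu, him⟩ := hz
  have hδ0 : 0 ≤ δ := (norm_nonneg _).trans hzu.le
  have hclose : ∀ ξ : Cvec (n + 1), ‖ξ - z‖ < δ * ‖z‖ → ‖r • ξ - u‖ ≤ 3 * δ := by
    intro ξ hξ
    have hrz : ‖r • z‖ ≤ 1 + δ := by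
      calc ‖r • z‖ = ‖u + (r • z - u)‖ := by congr 1; abel
        _ ≤ 1 + δ := (norm_add_le _ _).trans (by rw [hu]; linarith)
    have h1 : ‖r • (ξ - z)‖ ≤ δ * (1 + δ) := by
      rw [norm_smul, Real.norm_eq_abs, abs_of_pos hr] at hrz ⊢
      nlinarith [norm_nonneg z]
    calc ‖r • ξ - u‖ = ‖r • (ξ - z) + (r • z - u)‖ := by rw [smul_sub]; congr 1; abel
      _ ≤ δ * (1 + δ) + δ := (norm_add_le _ _).trans (by linarith)
      _ ≤ 3 * δ := by nlinarith
  have hζu := hclose ζ hζz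
  have hηu := hclose η hηz
  set s := r • ζ + r • η with hs
  have hsu : ∀ i, ‖s i - 2 * u i‖ ≤ 6 * δ := by
    intro i
    have h1 := (PiLp.norm_apply_le (r • ζ - u) i).trans hζu
    have h2 := (PiLp.norm_apply_le (r • η - u) i).trans hηu
    calc ‖s i - 2 * u i‖ = ‖(r • ζ - u) i + (r • η - u) i‖ := by
          congr 1; simp only [hs, PiLp.add_apply, PiLp.sub_apply]; ring
      _ ≤ _ := (norm_add_le _ _).trans (by linarith)
  have hzi : ∀ i, ‖(r • z) i - u i‖ ≤ δ := fun i =>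
    (PiLp.norm_apply_le (r • z - u) i).trans hzu.le
  have hui : ∀ i, ‖u i‖ ≤ 1 := fun i => (PiLp.norm_apply_le u i).trans hu.le
  have hprod : ∀ a b, ‖s a * conj ((r • z) b) - 2 * (u a * conj (u b))‖ ≤ 10 * δ := by
    intro a b
    have e : s a * conj ((r • z) b) - 2 * (u a * conj (u b)) =
        (s a - 2 * u a) * conj ((r • z) b - u b) + (s a - 2 * u a) * conj (u b)
          + 2 * u a * conj ((r • z) b - u b) := by
      simp only [map_sub]; ring
    rw [e]
    refine (norm_add₃_le).trans ?_
    simp only [norm_mul, RCLike.norm_conj, RCLike.norm_ofNat]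
    have h1 := hsu a
    have h2 := hzi b
    have h3 := hui a
    have h4 := hui b
    have p1 := mul_le_mul h1 h2 (norm_nonneg _) (by linarith)
    have p2 := mul_le_mul h1 h4 (norm_nonneg _) (by linarith)
    have p3 := mul_le_mul h3 h2 (norm_nonneg _) (by linarith)
    nlinarith
  have hdet : 2 * c ≤ ‖s j * conj ((r • z) k) - s k * conj ((r • z) j)‖ := by
    have e0 : 2 * (u j * conj (u k)) - 2 * (u k * conj (u j)) =
        ((4 * (u j * conj (u k)).im : ℝ) : ℂ) * Complex.I := by
      have h1 : u k * conj (u j) = conj (u j * conj (u k)) := by simp [mul_comm]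
      rw [h1, ← mul_sub, Complex.sub_conj]; push_cast; ring
    have h0 : 4 * c ≤ ‖2 * (u j * conj (u k)) - 2 * (u k * conj (u j))‖ := by
      rw [e0, norm_mul, Complex.norm_real, Complex.norm_I, Real.norm_eq_abs, abs_mul]
      rw [abs_of_pos (by norm_num : (0 : ℝ) < 4), mul_one]
      linarith
    have h1 := hprod j k
    have h2 := hprod k j
    have h3 : ‖2 * (u j * conj (u k)) - 2 * (u k * conj (u j))‖ ≤
        ‖s j * conj ((r • z) k) - s k * conj ((r • z) j)‖ +
        ‖s j * conj ((r • z) k) - 2 * (u j * conj (u k))‖ +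
        ‖s k * conj ((r • z) j) - 2 * (u k * conj (u j))‖ := by
      rw [← norm_neg (s j * conj ((r • z) k) - 2 * (u j * conj (u k)))]
      refine le_trans (le_of_eq ?_) norm_add₃_le
      congr 1; ring
    have h4 : 20 * δ ≤ 2 * c := by linarith
    linarith
  have hsD : ∑ i, (r • (ζ - η)) i * s i = 0 := by
    have h1 : ∀ i, (r • (ζ - η)) i * s i = r ^ 2 * (ζ i * ζ i) - r ^ 2 * (η i * η i) := by
      intro i
      simp only [hs, PiLp.add_apply, PiLp.sub_apply, PiLp.smul_apply, Complex.real_smul]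
      ring
    simp_rw [h1]
    rw [Finset.sum_sub_distrib, ← Finset.mul_sum, ← Finset.mul_sum, hζ.2, hη.2]
    simp
  have hrz : ‖r • z‖ ≤ 4 := by
    calc ‖r • z‖ = ‖u + (r • z - u)‖ := by congr 1; abel
      _ ≤ 4 := (norm_add_le _ _).trans (by rw [hu]; linarith)
  have hs4 : ‖s‖ ≤ 4 := by
    calc ‖s‖ = ‖(r • ζ - u) + (r • η - u) + (2 : ℝ) • u‖ := by
          congr 1; rw [hs, two_smul]; abel
      _ ≤ 3 * δ + 3 * δ + 2 := norm_add₃_le.trans (by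
          rw [norm_smul, hu]; norm_num; linarith)
      _ ≤ 4 := by linarith
  have key := norm_le_of_det hjk (by positivity : 0 < 2 * c) hrz hs4 hsD hdet
  rw [chartMap_smul_base _ _ _ _ hr, chartMap_smul, norm_smul, norm_smul, chartMap_sub,
    mul_left_comm] at key
  have := le_of_mul_le_mul_left key (norm_pos_iff.2 hr.ne')
  norm_num at this ⊢
  exact this

end Chart

/-! ### The canonical measure of the cone -/

/-- The canonical measure of `ℍₙ`, as a measure on `ℂⁿ⁺¹`. -/
def coneMeasure (n : ℕ) : Measure (Cvec (n + 1)) := (μHE[2 * n]).restrict (cone n)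

/-- `|ζ / ζ_last|^β`. -/
def angular {k : ℕ} (β : ℝ) (ζ : Cvec k) : ℝ≥0∞ := (‖ζ‖ₑ / ‖lastCoord ζ‖ₑ) ^ β

section

variable {n : ℕ}

theorem finrank_cvec (k : ℕ) : Module.finrank ℝ (Cvec k) = 2 * k := by
  rw [finrank_real_of_complex]; simp

theorem euclideanHausdorffMeasure_cvec (k : ℕ) : (μHE[2 * k] : Measure (Cvec k)) = volume := by
  rw [← finrank_cvec k]
  exact InnerProductSpace.euclideanHausdorffMeasure_eq_volume

theorem isClosed_isotropic (n : ℕ) : IsClosed {z : Cvec (n + 1) | ∑ j, z j * z j = 0} :=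
  isClosed_eq (by fun_prop) continuous_const

theorem measurableSet_cone (n : ℕ) : MeasurableSet (cone n) := by
  have h : cone n = {z : Cvec (n + 1) | ∑ j, z j * z j = 0} \ {0} := by
    ext z; simp [cone, and_comm]
  rw [h]
  exact (isClosed_isotropic n).measurableSet.diff (measurableSet_singleton 0)

theorem smul_mem_cone {r : ℝ} (hr : r ≠ 0) {z : Cvec (n + 1)} : r • z ∈ cone n ↔ z ∈ cone n := by
  have h : ∀ j, (r • z) j * (r • z) j = (r : ℂ) ^ 2 * (z j * z j) := by
    intro j
    simp only [PiLp.smul_apply, Complex.real_smul]; ring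
  simp only [cone, Set.mem_ofPred_eq, h, ← Finset.mul_sum]
  simp [hr]

theorem homogeneousMeasure_coneMeasure (n : ℕ) : HomogeneousMeasure (coneMeasure n) (2 * n) := by
  refine homogeneousMeasure_of_preimage fun r hr s hs => ?_
  have hm : Measurable (fun x : Cvec (n + 1) => r • x) := (continuous_const_smul r).measurable
  rw [coneMeasure, Measure.restrict_apply hs, Measure.restrict_apply (hm hs)]
  have h : (fun x : Cvec (n + 1) => r • x) ⁻¹' s ∩ cone n = r⁻¹ • (s ∩ cone n) := by
    rw [← Set.preimage_smul₀ hr.ne']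
    ext x
    simp [smul_mem_cone hr.ne']
  rw [h, Measure.euclideanHausdorffMeasure_smul₀ _ (inv_ne_zero hr.ne'), ENNReal.smul_def,
    smul_eq_mul, ← mul_assoc, ENNReal.coe_pow, ← mul_pow]
  have : ENNReal.ofReal r * ((‖r⁻¹‖₊ : NNReal) : ℝ≥0∞) = 1 := by
    rw [← enorm_eq_nnnorm, Real.enorm_eq_ofReal (by positivity), ← ENNReal.ofReal_mul hr.le,
      mul_inv_cancel₀ hr.ne', ENNReal.ofReal_one]
  rw [this, one_pow, one_mul]

theorem homogeneousMeasure_volume (k : ℕ) :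
    HomogeneousMeasure (volume : Measure (Cvec k)) (2 * k) := by
  rw [← finrank_cvec k]
  exact homogeneousMeasure_addHaar _

/-- The inverse Lipschitz constant of the charts. -/
def chartConst (n : ℕ) (c : ℝ) : NNReal := Real.toNNReal (n + 2 * (16 * (n + 2) / (2 * c)))

theorem dist_le_of_admissible {c δ : ℝ} (hc : 0 < c) (hδc : 18 * δ ≤ c)
    (hδ1 : δ ≤ 1 / 3) {j k : Fin (n + 1)} (hjk : j ≠ k) {z : Cvec (n + 1)}
    (hz : Admissible c δ j k z) :
    ∀ ζ ∈ cone n ∩ {ζ | ‖ζ - z‖ < δ * ‖z‖}, ∀ η ∈ cone n ∩ {ζ | ‖ζ - z‖ < δ * ‖z‖},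
      dist ζ η ≤ chartConst n c * dist (chartMap j k z ζ) (chartMap j k z η) := by
  intro ζ hζ η hη
  rw [dist_eq_norm, dist_eq_norm, chartConst, Real.coe_toNNReal _ (by positivity)]
  exact norm_sub_le_of_admissible hc hδc hδ1 hjk hz hζ.1 hη.1 hζ.2 hη.2

theorem map_chartMap_le {c δ : ℝ} (hc : 0 < c) (hδc : 18 * δ ≤ c)
    (hδ1 : δ ≤ 1 / 3) {j k : Fin (n + 1)} (hjk : j ≠ k) {z : Cvec (n + 1)}
    (hz : Admissible c δ j k z) :
    ((coneMeasure n).restrict {ζ | ‖ζ - z‖ < δ * ‖z‖}).map (chartMap j k z) ≤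
      (chartConst n c : ℝ≥0∞) ^ (2 * n) • volume := by
  have hΦ := (continuous_chartMap j k z).measurable
  refine Measure.le_intro fun B hB _ => ?_
  rw [Measure.map_apply hΦ hB, Measure.restrict_apply (hΦ hB), coneMeasure,
    Measure.restrict_apply' (measurableSet_cone n), Measure.smul_apply, smul_eq_mul,
    ← euclideanHausdorffMeasure_cvec]
  refine (euclideanHausdorffMeasure_le_image (K := chartConst n c) (f := chartMap j k z)
    fun ζ hζ η hη => dist_le_of_admissible hc hδc hδ1 hjk hz ζ ⟨hζ.2, hζ.1.2⟩ η ⟨hη.2, hη.1.2⟩).trans ?_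
  gcongr
  rintro _ ⟨ζ, hζ, rfl⟩
  exact hζ.1.1

theorem lintegral_chartMap_le {c δ : ℝ} (hc : 0 < c) (hδc : 18 * δ ≤ c)
    (hδ1 : δ ≤ 1 / 3) {j k : Fin (n + 1)} (hjk : j ≠ k) {z : Cvec (n + 1)}
    (hz : Admissible c δ j k z) {f : Cvec n → ℝ≥0∞} (hf : Measurable f) :
    ∫⁻ ζ in {ζ | ‖ζ - z‖ < δ * ‖z‖}, f (chartMap j k z ζ) ∂coneMeasure n ≤
      (chartConst n c : ℝ≥0∞) ^ (2 * n) * ∫⁻ ζ', f ζ' := by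
  rw [← lintegral_map hf (continuous_chartMap j k z).measurable]
  refine (lintegral_mono' (map_chartMap_le hc hδc hδ1 hjk hz) le_rfl).trans_eq ?_
  rw [lintegral_smul_measure, smul_eq_mul]

/-! ### The angular weight -/

theorem lastCoord_eq {k : ℕ} (v : Cvec (k + 1)) : lastCoord v = v (Fin.last k) := by
  simp [lastCoord, Fin.last]

theorem measurable_lastCoord (k : ℕ) : Measurable (lastCoord : Cvec k → ℂ) := by
  unfold lastCoord
  split_ifs <;> fun_prop

theorem measurable_angular {k : ℕ} (β : ℝ) : Measurable (angular β : Cvec k → ℝ≥0∞) :=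
  (measurable_enorm.div (measurable_lastCoord k).enorm).pow_const β

theorem lastCoord_smul {k : ℕ} (r : ℝ) (v : Cvec k) : lastCoord (r • v) = r • lastCoord v := by
  unfold lastCoord
  split_ifs <;> simp

theorem angular_smul {k : ℕ} (β : ℝ) {r : ℝ} (hr : 0 < r) (v : Cvec k) :
    angular β (r • v) = angular β v := by
  have h0 : ‖r‖ₑ ≠ 0 := by simpa using hr.ne'
  rw [angular, lastCoord_smul, enorm_smul, enorm_smul, ENNReal.mul_div_mul_left _ _ h0 enorm_ne_top,
    angular]

theorem norm_lastCoord_le {k : ℕ} (v : Cvec k) : ‖lastCoord v‖ ≤ ‖v‖ := by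
  unfold lastCoord
  split_ifs
  · exact PiLp.norm_apply_le v _
  · simp

theorem one_le_angular {k : ℕ} {β : ℝ} (hβ : 0 ≤ β) {v : Cvec k} (hv : v ≠ 0) :
    1 ≤ angular β v := by
  rw [angular, ← ENNReal.one_rpow β]
  refine ENNReal.rpow_le_rpow ?_ hβ
  refine (ENNReal.le_div_iff_mul_le (Or.inr (by simpa using hv)) (Or.inl enorm_ne_top)).2 ?_
  rw [one_mul, ← ofReal_norm, ← ofReal_norm]
  exact ENNReal.ofReal_le_ofReal (norm_lastCoord_le v)

theorem angular_le_of_norm_le {k k' : ℕ} {β : ℝ} (hβ : 0 ≤ β) {v : Cvec k} {w : Cvec k'} {A : ℝ}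
    (hA : 0 < A) (hw : w ≠ 0) (h : ‖v‖ * ‖lastCoord w‖ ≤ A * (‖w‖ * ‖lastCoord v‖)) :
    angular β v ≤ ENNReal.ofReal A ^ β * angular β w := by
  rw [angular, angular, ← ENNReal.mul_rpow_of_nonneg _ _ hβ]
  refine ENNReal.rpow_le_rpow ?_ hβ
  rcases eq_or_ne (lastCoord w) 0 with h0 | h0
  · simp [h0, ENNReal.div_zero (enorm_ne_zero.2 hw), ENNReal.mul_top, hA]
  · refine ENNReal.div_le_of_le_mul ?_
    rw [mul_assoc, ← ENNReal.mul_div_right_comm, ← mul_div_assoc]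
    refine (ENNReal.le_div_iff_mul_le (Or.inl (by simpa using h0)) (Or.inl enorm_ne_top)).2 ?_
    simp only [← ofReal_norm]
    rw [← ENNReal.ofReal_mul (norm_nonneg _), ← ENNReal.ofReal_mul (norm_nonneg _),
      ← ENNReal.ofReal_mul hA.le]
    exact ENNReal.ofReal_le_ofReal h

theorem angular_le_angular_chartMap {c δ β : ℝ} (hβ : 0 ≤ β) (hc : 0 < c) (hδc : 18 * δ ≤ c)
    (hδ1 : δ ≤ 1 / 3) {j k : Fin (n + 1)} (hjk : j < k) {z ζ : Cvec (n + 1)}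
    (hz : Admissible c δ j k z) (hζ : ‖ζ - z‖ < δ * ‖z‖) :
    angular β ζ ≤ ENNReal.ofReal (2 + 4 / c) ^ β * angular β (chartMap j k z ζ) := by
  obtain ⟨r, hr, u, hu, hzu, him⟩ := hz
  have hδ0 : 0 ≤ δ := (norm_nonneg _).trans hzu.le
  have hz0 : 0 < ‖z‖ := by
    rcases (norm_nonneg z).eq_or_lt with h | h
    · rw [← h, mul_zero] at hζ
      exact absurd hζ (not_lt.2 (norm_nonneg _))
    · exact h
  have hζ1 : ‖ζ‖ ≤ 4 / 3 * ‖z‖ := by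
    calc ‖ζ‖ = ‖z + (ζ - z)‖ := by congr 1; abel
      _ ≤ ‖z‖ + ‖ζ - z‖ := norm_add_le _ _
      _ ≤ _ := by nlinarith
  have hζ2 : 2 / 3 * ‖z‖ ≤ ‖chartMap j k z ζ‖ := by
    have h1 : ‖chartMap j k z (z - ζ)‖ ≤ δ * ‖z‖ := by
      refine (norm_chartMap_le hjk.ne _ _).trans ?_
      rw [norm_sub_rev]; exact hζ.le
    have h2 : ‖z‖ ≤ ‖chartMap j k z (z - ζ)‖ + ‖chartMap j k z ζ‖ := by
      rw [← norm_chartMap_self hjk.ne z]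
      refine le_trans (le_of_eq ?_) (norm_add_le _ _)
      rw [chartMap_sub, sub_add_cancel]
    nlinarith
  have hΦ0 : chartMap j k z ζ ≠ 0 := norm_pos_iff.1 (by linarith)
  have hA : 0 ≤ 4 / c := by positivity
  refine angular_le_of_norm_le hβ (by positivity) hΦ0 ?_
  rcases n with _ | n
  · exact absurd hjk (by have := Fin.eq_zero j; have := Fin.eq_zero k; simp_all)
  rcases eq_or_ne k (Fin.last (n + 1)) with hk | hk
  · have hrz : ‖r • z‖ ≤ 1 + δ := by
      calc ‖r • z‖ = ‖u + (r • z - u)‖ := by congr 1; abel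
        _ ≤ 1 + δ := (norm_add_le _ _).trans (by rw [hu]; linarith)
    have hrζ : ‖r • (ζ - z)‖ ≤ δ * (1 + δ) := by
      rw [norm_smul, Real.norm_eq_abs, abs_of_pos hr] at hrz ⊢
      nlinarith
    have hζu : ‖r • ζ - u‖ ≤ 3 * δ := by
      calc ‖r • ζ - u‖ = ‖r • (ζ - z) + (r • z - u)‖ := by rw [smul_sub]; congr 1; abel
        _ ≤ δ * (1 + δ) + δ := (norm_add_le _ _).trans (by linarith)
        _ ≤ 3 * δ := by nlinarith
    have huk : c ≤ ‖u k‖ := by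
      have h1 := him.trans (Complex.abs_im_le_norm _)
      rw [norm_mul, RCLike.norm_conj] at h1
      have h2 : ‖u j‖ ≤ 1 := (PiLp.norm_apply_le u j).trans hu.le
      nlinarith [norm_nonneg (u k), norm_nonneg (u j)]
    have hk1 : ‖u k‖ ≤ ‖(r • ζ) k‖ + 3 * δ := by
      have h1 : ‖(r • ζ - u) k‖ ≤ 3 * δ := (PiLp.norm_apply_le _ k).trans hζu
      have h2 : ‖u k‖ ≤ ‖(r • ζ) k‖ + ‖(r • ζ - u) k‖ := by
        refine le_trans (le_of_eq ?_) (norm_sub_le _ _)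
        congr 1; simp
      linarith
    have hrζ2 : ‖r • ζ‖ ≤ 2 := by
      calc ‖r • ζ‖ = ‖u + (r • ζ - u)‖ := by congr 1; abel
        _ ≤ 2 := (norm_add_le _ _).trans (by rw [hu]; linarith)
    have h5 : c / 2 ≤ r * ‖ζ k‖ := by
      rw [PiLp.smul_apply, norm_smul, Real.norm_eq_abs, abs_of_pos hr] at hk1
      linarith
    rw [norm_smul, Real.norm_eq_abs, abs_of_pos hr] at hrζ2
    have h6 : ‖ζ‖ ≤ 4 / c * ‖ζ k‖ := by
      rw [div_mul_eq_mul_div, le_div_iff₀ hc]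
      have : r * (‖ζ‖ * c) ≤ r * (4 * ‖ζ k‖) := by nlinarith
      exact le_of_mul_le_mul_left this hr
    rw [lastCoord_eq ζ, ← hk]
    have h7 := norm_lastCoord_le (chartMap j k z ζ)
    have h8 : ‖ζ‖ ≤ (2 + 4 / c) * ‖ζ k‖ := by nlinarith [norm_nonneg (ζ k)]
    have := mul_le_mul h8 h7 (norm_nonneg _) (by positivity)
    linarith
  · have hl : lastCoord (chartMap j k z ζ) = lastCoord ζ := by
      have hj : j ≠ Fin.last (n + 1) := (lt_of_lt_of_le hjk (Fin.le_last k)).ne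
      rw [lastCoord_eq, lastCoord_eq]
      have h1 : j.succAbove (Fin.last n) = Fin.last (n + 1) := Fin.succAbove_ne_last_last hj
      simp [chartMap, h1, hk.symm]
    rw [hl, ← mul_assoc]
    refine mul_le_mul_of_nonneg_right ?_ (norm_nonneg _)
    nlinarith [norm_nonneg (chartMap j k z ζ)]

end

/-! ### Finiteness of the weighted volumes -/

theorem setLIntegral_enorm_inv_rpow_lt_top {E : Type*} [NormedAddCommGroup E] [NormedSpace ℝ E]
    [FiniteDimensional ℝ E] [MeasurableSpace E] [BorelSpace E] (μ : Measure E)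
    [μ.IsAddHaarMeasure] {β : ℝ} (hd : 1 ≤ Module.finrank ℝ E) (hβ : β < Module.finrank ℝ E)
    (R : ℝ) : ∫⁻ w in Metric.ball (0 : E) R, (‖w‖ₑ⁻¹) ^ β ∂μ < ∞ := by
  have : Nontrivial E := Module.nontrivial_of_finrank_pos (R := ℝ) (by omega)
  have h : IntegrableOn (fun w : E => ‖w‖ ^ (-β)) (Metric.ball 0 R) μ := by
    refine integrableOn_ball_of_norm_le_rpow (C := 1) hd hβ (ae_of_all _ fun w => ?_) ?_
    · rw [Real.norm_eq_abs, abs_of_nonneg (by positivity), one_mul]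
    · exact (measurable_norm.pow_const _).aestronglyMeasurable
  refine lt_of_le_of_lt (lintegral_mono_ae ?_) h.hasFiniteIntegral
  have h0 : ∀ᵐ w ∂μ.restrict (Metric.ball 0 R), w ≠ 0 :=
    ae_restrict_of_ae (Measure.ae_ne μ 0)
  filter_upwards [h0] with w hw
  rw [Real.enorm_eq_ofReal (by positivity), ENNReal.inv_rpow, ← ENNReal.rpow_neg, ← ofReal_norm,
    ENNReal.ofReal_rpow_of_pos (norm_pos_iff.2 hw)]

theorem setLIntegral_angular_lt_top {k : ℕ} {β : ℝ} (hβ0 : 0 ≤ β) (hβ : β < 2) (R : ℝ) :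
    ∫⁻ v in Metric.ball (0 : Cvec (k + 1)) R, angular β v < ∞ := by
  set e : Cvec (k + 1) ≃L[ℝ] (Fin (k + 1) → ℂ) := PiLp.continuousLinearEquiv 2 ℝ _ with he
  have hc : (volume : Measure (Cvec (k + 1))).map e =
      Measure.addHaarScalarFactor ((volume : Measure (Cvec (k + 1))).map e) volume •
        (volume : Measure (Fin (k + 1) → ℂ)) := Measure.isAddLeftInvariant_eq_smul _ _
  set c := Measure.addHaarScalarFactor ((volume : Measure (Cvec (k + 1))).map e) volume
  set h : ℂ → ℝ≥0∞ := (Metric.ball (0 : ℂ) R).indicator fun w => (‖w‖ₑ⁻¹) ^ β with hh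
  set b : (Fin k → ℂ) → ℝ≥0∞ := (Metric.ball (0 : Fin k → ℂ) R).indicator 1 with hb
  have hhm : Measurable h :=
    (measurable_enorm.inv.pow_const β).indicator Metric.isOpen_ball.measurableSet
  have hbm : Measurable b := measurable_one.indicator Metric.isOpen_ball.measurableSet
  set G : (Fin (k + 1) → ℂ) → ℝ≥0∞ := fun x =>
    h (x (Fin.last k)) * b (fun i => x ((Fin.last k).succAbove i)) with hG
  have hGm : Measurable G := (hhm.comp (by fun_prop)).mul (hbm.comp (by fun_prop))
  have hGint : ∫⁻ x, G x < ∞ := by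
    have hp := volume_preserving_piFinSuccAbove (fun _ : Fin (k + 1) => ℂ) (Fin.last k)
    have h1 : ∫⁻ x, G x = ∫⁻ p : ℂ × (Fin k → ℂ), h p.1 * b p.2 := by
      have hm : Measurable fun p : ℂ × (Fin k → ℂ) => h p.1 * b p.2 :=
        (hhm.comp measurable_fst).mul (hbm.comp measurable_snd)
      exact hp.lintegral_comp hm
    rw [h1]
    have h2 := lintegral_prod_mul (μ := (volume : Measure ℂ))
      (ν := (volume : Measure (Fin k → ℂ))) hhm.aemeasurable hbm.aemeasurable
    refine h2.trans_lt (ENNReal.mul_lt_top ?_ ?_)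
    · rw [hh, lintegral_indicator Metric.isOpen_ball.measurableSet]
      exact setLIntegral_enorm_inv_rpow_lt_top volume (by simp) (by simpa using hβ) R
    · rw [hb, lintegral_indicator_one Metric.isOpen_ball.measurableSet]
      exact Metric.isBounded_ball.measure_lt_top
  have hle : ∫⁻ v in Metric.ball (0 : Cvec (k + 1)) R, angular β v ≤
      ∫⁻ v, ENNReal.ofReal R ^ β * G (e v) := by
    rw [← lintegral_indicator Metric.isOpen_ball.measurableSet]
    refine lintegral_mono fun v => ?_
    by_cases hv : v ∈ Metric.ball (0 : Cvec (k + 1)) R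
    swap
    · rw [Set.indicator_of_notMem hv]; exact zero_le
    rw [Set.indicator_of_mem hv]
    have hvR : ‖v‖ < R := by simpa using hv
    have hvi : ∀ i, ‖v i‖ < R := fun i => (PiLp.norm_apply_le v i).trans_lt hvR
    have hev : ∀ i, e v i = v i := fun i => rfl
    have h1 : h (e v (Fin.last k)) = (‖v (Fin.last k)‖ₑ⁻¹) ^ β := by
      rw [hh, Set.indicator_of_mem]
      · rfl
      · rw [mem_ball_zero_iff]
        exact hvi _
    have h2 : b (fun i => e v ((Fin.last k).succAbove i)) = 1 := by
      rw [hb, Set.indicator_of_mem]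
      · rfl
      · rw [mem_ball_zero_iff, pi_norm_lt_iff ((norm_nonneg v).trans_lt hvR)]
        exact fun i => hvi _
    simp only [hG, h1, h2, mul_one]
    rw [angular, lastCoord_eq, div_eq_mul_inv, ENNReal.mul_rpow_of_nonneg _ _ hβ0]
    gcongr
    rw [← ofReal_norm]
    exact ENNReal.ofReal_le_ofReal hvR.le
  refine hle.trans_lt ?_
  rw [lintegral_const_mul (f := fun v => G (e v)) _ (hGm.comp e.continuous.measurable),
    ← lintegral_map hGm e.continuous.measurable, hc, lintegral_smul_measure]
  exact ENNReal.mul_lt_top (ENNReal.rpow_lt_top_of_nonneg hβ0 ENNReal.ofReal_ne_top)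
    (ENNReal.mul_lt_top ENNReal.coe_lt_top hGint)

section

variable {n : ℕ}

theorem exists_admissible_of_mem_cone {z : Cvec (n + 1)} (hz : z ∈ cone n) {δ : ℝ} (hδ : 0 < δ) :
    ∃ j k : Fin (n + 1), j < k ∧ Admissible (1 / (2 * ((n : ℝ) + 1))) δ j k z := by
  have hz0 : 0 < ‖z‖ := norm_pos_iff.2 hz.1
  have hs : ‖z‖⁻¹ • z ∈ coneSphere n :=
    ⟨(smul_mem_cone (inv_ne_zero hz0.ne')).2 hz, by
      rw [norm_smul, norm_inv, norm_norm, inv_mul_cancel₀ hz0.ne']⟩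
  obtain ⟨j, k, hjk, h⟩ := exists_im_ge (by positivity) le_rfl hs
  exact ⟨j, k, hjk, ‖z‖⁻¹, inv_pos.2 hz0, _, hs.2, by simpa using hδ, h⟩

/-- Admissible constants for charts centered at the points of the cone. -/
def coneRadius (n : ℕ) : ℝ := 1 / (36 * ((n : ℝ) + 1))

theorem coneRadius_pos (n : ℕ) : 0 < coneRadius n := by unfold coneRadius; positivity

theorem coneRadius_le (n : ℕ) : 18 * coneRadius n ≤ 1 / (2 * ((n : ℝ) + 1)) := by
  unfold coneRadius
  have : (0 : ℝ) < n + 1 := by positivity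
  rw [show (36 * ((n : ℝ) + 1)) = 18 * (2 * (n + 1)) by ring]
  field_simp
  norm_num

theorem coneRadius_le_third (n : ℕ) : coneRadius n ≤ 1 / 3 := by
  unfold coneRadius
  have : (0 : ℝ) ≤ n := by positivity
  rw [div_le_div_iff₀ (by positivity) (by positivity)]
  linarith

theorem setLIntegral_patch_lt_top (hn : 1 ≤ n) {β : ℝ} (hβ0 : 0 ≤ β) (hβ : β < 2)
    {z : Cvec (n + 1)} (hz : z ∈ cone n) :
    ∫⁻ ζ in {ζ | ‖ζ - z‖ < coneRadius n * ‖z‖}, angular β ζ ∂coneMeasure n < ∞ := by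
  obtain ⟨j, k, hjk, hadm⟩ := exists_admissible_of_mem_cone hz (coneRadius_pos n)
  have hc : (0 : ℝ) < 1 / (2 * ((n : ℝ) + 1)) := by positivity
  have hU : MeasurableSet {ζ : Cvec (n + 1) | ‖ζ - z‖ < coneRadius n * ‖z‖} :=
    measurableSet_lt (by fun_prop) measurable_const
  obtain ⟨n, rfl⟩ : ∃ n', n = n' + 1 := ⟨n - 1, by omega⟩
  set A := ENNReal.ofReal (2 + 4 / (1 / (2 * (((n + 1 : ℕ) : ℝ) + 1)))) ^ β with hA
  have hA' : A < ∞ := ENNReal.rpow_lt_top_of_nonneg hβ0 ENNReal.ofReal_ne_top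
  set B := Metric.ball (0 : Cvec (n + 1)) (2 * ‖z‖) with hB
  have hf : Measurable (fun v : Cvec (n + 1) => A * B.indicator (angular β) v) :=
    ((measurable_angular β).indicator Metric.isOpen_ball.measurableSet).const_mul A
  have key := lintegral_chartMap_le hc (coneRadius_le _) (coneRadius_le_third _) hjk.ne hadm hf
  refine lt_of_le_of_lt (le_trans (setLIntegral_mono' hU fun ζ hζ => ?_) key) ?_
  · have hmem : chartMap j k z ζ ∈ B := by
      rw [hB, mem_ball_zero_iff]
      refine (norm_chartMap_le hjk.ne _ _).trans_lt ?_
      have hz0 : 0 < ‖z‖ := norm_pos_iff.2 hz.1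
      have h1 : ‖ζ‖ ≤ ‖z‖ + ‖ζ - z‖ := by
        refine le_trans (le_of_eq ?_) (norm_add_le _ _)
        congr 1; abel
      have h2 : ‖ζ - z‖ < coneRadius (n + 1) * ‖z‖ := hζ
      nlinarith [coneRadius_le_third (n + 1)]
    rw [Set.indicator_of_mem hmem]
    exact angular_le_angular_chartMap hβ0 hc (coneRadius_le _) (coneRadius_le_third _) hjk hadm hζ
  · rw [lintegral_const_mul _ ((measurable_angular β).indicator Metric.isOpen_ball.measurableSet),
      lintegral_indicator Metric.isOpen_ball.measurableSet]
    exact ENNReal.mul_lt_top (ENNReal.pow_lt_top ENNReal.coe_lt_top)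
      (ENNReal.mul_lt_top hA' (setLIntegral_angular_lt_top hβ0 hβ _))

theorem setLIntegral_annulus_lt_top (hn : 1 ≤ n) {β : ℝ} (hβ0 : 0 ≤ β) (hβ : β < 2) {a : ℝ}
    (ha : 0 < a) (b : ℝ) :
    ∫⁻ ζ in {ζ | a ≤ ‖ζ‖ ∧ ‖ζ‖ ≤ b}, angular β ζ ∂coneMeasure n < ∞ := by
  set S : Set (Cvec (n + 1)) := {z | ∑ j, z j * z j = 0} ∩ {ζ | a ≤ ‖ζ‖ ∧ ‖ζ‖ ≤ b} with hS
  have hcl : IsClosed S :=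
    (isClosed_isotropic n).inter ((isClosed_le continuous_const continuous_norm).inter
      (isClosed_le continuous_norm continuous_const))
  have hcomp : IsCompact S :=
    Metric.isCompact_of_isClosed_isBounded hcl
      ((Metric.isBounded_closedBall (x := (0 : Cvec (n + 1))) (r := b)).subset fun z hz => by
        simpa using hz.2.2)
  have hSc : ∀ z ∈ S, z ∈ cone n := fun z hz =>
    ⟨fun h0 => by have := hz.2.1; rw [h0, norm_zero] at this; linarith, hz.1⟩
  obtain ⟨t, htS, ht⟩ := hcomp.elim_nhds_subcover
    (fun z => {ζ | ‖ζ - z‖ < coneRadius n * ‖z‖}) fun z hz => by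
      refine (isOpen_lt (by fun_prop) continuous_const).mem_nhds ?_
      simpa using mul_pos (coneRadius_pos n) (norm_pos_iff.2 (hSc z hz).1)
  have hm : MeasurableSet {ζ : Cvec (n + 1) | a ≤ ‖ζ‖ ∧ ‖ζ‖ ≤ b} :=
    (measurableSet_le measurable_const measurable_norm).inter
      (measurableSet_le measurable_norm measurable_const)
  have hle : (coneMeasure n).restrict {ζ | a ≤ ‖ζ‖ ∧ ‖ζ‖ ≤ b} ≤
      (coneMeasure n).restrict (⋃ z : t, {ζ | ‖ζ - z.1‖ < coneRadius n * ‖z.1‖}) := by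
    have hm' : MeasurableSet (⋃ z : t, {ζ : Cvec (n + 1) | ‖ζ - z.1‖ < coneRadius n * ‖z.1‖}) :=
      MeasurableSet.iUnion fun z => measurableSet_lt (by fun_prop) measurable_const
    rw [coneMeasure, Measure.restrict_restrict hm, Measure.restrict_restrict hm']
    refine Measure.restrict_mono_set _ ?_
    intro ζ hζ
    refine ⟨?_, hζ.2⟩
    obtain ⟨z, hz, h⟩ := Set.mem_iUnion₂.1 (ht ⟨hζ.2.2, hζ.1⟩)
    exact Set.mem_iUnion.2 ⟨⟨z, hz⟩, h⟩
  refine (lintegral_mono' hle le_rfl).trans_lt ((lintegral_iUnion_le _ _).trans_lt ?_)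
  rw [tsum_fintype]
  exact ENNReal.sum_lt_top.2 fun z _ => setLIntegral_patch_lt_top hn hβ0 hβ (hSc z (htS z z.2))

theorem sigmaFinite_coneMeasure (hn : 1 ≤ n) : SigmaFinite (coneMeasure n) := by
  refine ⟨⟨⟨fun i : ℕ => {ζ | ((i : ℝ) + 1)⁻¹ ≤ ‖ζ‖ ∧ ‖ζ‖ ≤ (i : ℝ) + 1} ∪ {0},
    fun _ => trivial, fun i => ?_, ?_⟩⟩⟩
  · refine (measure_union_le _ _).trans_lt (ENNReal.add_lt_top.2 ⟨?_, ?_⟩)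
    · have h := setLIntegral_annulus_lt_top hn le_rfl (by norm_num : (0 : ℝ) < 2)
        (inv_pos.2 (by positivity : (0 : ℝ) < (i : ℝ) + 1)) ((i : ℝ) + 1)
      simpa [angular] using h
    · rw [coneMeasure, Measure.restrict_apply' (measurableSet_cone n)]
      have : ({0} : Set (Cvec (n + 1))) ∩ cone n = ∅ := by
        ext ζ
        simp only [Set.mem_inter_iff, Set.mem_singleton_iff, Set.mem_empty_iff_false, iff_false]
        rintro ⟨rfl, h⟩
        exact h.1 rfl
      simp [this]
  · refine Set.eq_univ_of_forall fun ζ => Set.mem_iUnion.2 ?_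
    rcases eq_or_ne ζ 0 with rfl | h
    · exact ⟨0, Or.inr rfl⟩
    have h0 : 0 < ‖ζ‖ := norm_pos_iff.2 h
    obtain ⟨i, hi⟩ := exists_nat_ge (max ‖ζ‖ ‖ζ‖⁻¹)
    refine ⟨i, Or.inl ⟨inv_le_of_inv_le₀ h0 ?_, ?_⟩⟩
    · linarith [(le_max_right _ _).trans hi]
    · linarith [(le_max_left _ _).trans hi]

end

/-! ### The estimate for one factor -/

/-- `(1 + |z| / |ζ|)^α`. -/
def radial {k : ℕ} (α : ℝ) (z ζ : Cvec k) : ℝ≥0∞ := (1 + ‖z‖ₑ / ‖ζ‖ₑ) ^ α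

theorem measurable_radial {k : ℕ} (α : ℝ) (z : Cvec k) : Measurable (radial α z) :=
  (measurable_const.add (measurable_const.div measurable_enorm)).pow_const α

theorem radial_le_radial {k k' : ℕ} {α : ℝ} (hα : 0 ≤ α) {z ζ : Cvec k} {z' ζ' : Cvec k'}
    (hz : ‖z‖ = ‖z'‖) (hζ : ‖ζ'‖ ≤ ‖ζ‖) : radial α z ζ ≤ radial α z' ζ' := by
  have h1 : ‖z‖ₑ = ‖z'‖ₑ := by rw [← ofReal_norm, ← ofReal_norm, hz]
  have h2 : ‖ζ'‖ₑ ≤ ‖ζ‖ₑ := by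
    rw [← ofReal_norm, ← ofReal_norm]; exact ENNReal.ofReal_le_ofReal hζ
  rw [radial, radial, h1]
  gcongr

theorem radial_le_of_norm_le {k : ℕ} {α : ℝ} (hα : 0 ≤ α) {z ζ : Cvec k}
    (h : ‖z‖ ≤ 2 * ‖ζ‖) : radial α z ζ ≤ 3 ^ α := by
  refine ENNReal.rpow_le_rpow ?_ hα
  have : ‖z‖ₑ / ‖ζ‖ₑ ≤ 2 := by
    refine ENNReal.div_le_of_le_mul ?_
    have h2 := ENNReal.ofReal_le_ofReal h
    rwa [ENNReal.ofReal_mul (by norm_num), ofReal_norm, ofReal_norm, ENNReal.ofReal_ofNat] at h2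
  calc 1 + ‖z‖ₑ / ‖ζ‖ₑ ≤ 1 + 2 := by gcongr
    _ = 3 := by norm_num

theorem ae_volume_ne_zero (k : ℕ) : ∀ᵐ v : Cvec (k + 1), v ≠ 0 := Measure.ae_ne volume 0

theorem lintegral_le_lintegral_mul_angular {k : ℕ} {β : ℝ} (hβ : 0 ≤ β)
    (g : Cvec (k + 1) → ℝ≥0∞) : ∫⁻ v, g v ≤ ∫⁻ v, g v * angular β v := by
  refine lintegral_mono_ae ?_
  filter_upwards [ae_volume_ne_zero k] with v hv
  exact le_mul_of_one_le_right zero_le (one_le_angular hβ hv)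

theorem volume_annulus_ne_zero (k : ℕ) :
    volume {u : Cvec (k + 1) | ‖u‖ ≤ 1 ∧ 1 ≤ 2 * ‖u‖} ≠ 0 := by
  have hO : IsOpen {u : Cvec (k + 1) | ‖u‖ < 1 ∧ 1 < 2 * ‖u‖} :=
    (isOpen_lt continuous_norm continuous_const).inter (isOpen_lt (g := fun u => 2 * ‖u‖)
      continuous_const (by fun_prop))
  have hne : {u : Cvec (k + 1) | ‖u‖ < 1 ∧ 1 < 2 * ‖u‖}.Nonempty := by
    refine ⟨EuclideanSpace.single 0 (3 / 4), ?_⟩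
    simp only [Set.mem_ofPred_eq, PiLp.norm_single]
    norm_num
  refine ((hO.measure_pos volume hne).trans_le (measure_mono fun u hu => ?_)).ne'
  exact ⟨hu.1.le, hu.2.le⟩

theorem exists_lintegral_coneMeasure_le {k : ℕ} {β : ℝ} (hβ0 : 0 ≤ β) (hβ : β < 2) :
    ∃ A : NNReal, ∀ (f : Cvec (k + 1 + 1) → ℝ≥0∞) (g : Cvec (k + 1) → ℝ≥0∞), Measurable f →
      Measurable g → (∀ x ∈ cone (k + 1), ∀ y, ‖x‖ = ‖y‖ → f x ≤ g y) →
      ∫⁻ x, f x * angular β x ∂coneMeasure (k + 1) ≤ A * ∫⁻ y, g y := by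
  have hσ := sigmaFinite_coneMeasure (n := k + 1) (by omega)
  set M := ∫⁻ x in {x | 1 ≤ ‖x‖ ∧ ‖x‖ ≤ 2}, angular β x ∂coneMeasure (k + 1) with hM
  have hMt : M < ∞ := setLIntegral_annulus_lt_top (by omega) hβ0 hβ one_pos 2
  set v := volume {u : Cvec (k + 1) | ‖u‖ ≤ 1 ∧ 1 ≤ 2 * ‖u‖} with hv
  have hv0 : v ≠ 0 := volume_annulus_ne_zero k
  have hvt : v ≠ ∞ := by
    refine ((measure_mono fun u hu => ?_).trans_lt
      (Metric.isBounded_closedBall (x := (0 : Cvec (k + 1))) (r := 1)).measure_lt_top).ne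
    simpa using hu.1
  refine ⟨(M / v).toNNReal, fun f g hf hg hfg => ?_⟩
  rw [ENNReal.coe_toNNReal (ENNReal.div_lt_top hMt.ne hv0).ne]
  have hcm := measurableSet_cone (k + 1)
  have h := lintegral_mul_le_of_norm_eq_of_homogeneous (homogeneousMeasure_coneMeasure (k + 1))
    (homogeneousMeasure_volume (k + 1)) (measurable_angular β) (hf.indicator hcm) hg
    (fun r hr x => angular_smul β hr x)
    (Set.indicator_of_notMem (fun h => h.1 rfl) _) (fun x y hxy => by
      by_cases hx : x ∈ cone (k + 1)
      · rw [Set.indicator_of_mem hx]; exact hfg x hx y hxy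
      · rw [Set.indicator_of_notMem hx]; exact zero_le)
  have he : ∫⁻ x, f x * angular β x ∂coneMeasure (k + 1) =
      ∫⁻ x, (cone (k + 1)).indicator f x * angular β x ∂coneMeasure (k + 1) := by
    refine setLIntegral_congr_fun hcm fun x hx => ?_
    simp only [Set.indicator_of_mem hx]
  rw [he, ← ENNReal.mul_div_right_comm]
  refine (ENNReal.le_div_iff_mul_le (Or.inl hv0) (Or.inl hvt)).2 ?_
  rw [mul_comm]
  exact h

section Components

variable {n : ℕ} {C₀ δ C₁ : ℝ} {P : ChartChoice n C₀ δ} {z : Cvec (n + 1)}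

theorem CompBase.norm_eq {z' : Cvec n} (h : CompBase P C₁ z z') : ‖z'‖ = ‖z‖ := by
  by_cases hz : z ∈ chartDomain n δ ∧ (patch C₁ z).Nonempty
  · rw [h.1 hz]
    exact norm_chartMap_self (P.lt_of_mem z hz.1).ne z
  · exact h.2 hz

theorem mem_chartDomain_of_near (hC₁ : 1 < C₁) (hδ : 0 < δ) (hδC : 1 / δ + 1 < C₁)
    {ζ : Cvec (n + 1)} (hζ : ζ ∈ cone n) (hn : ‖ζ - z‖ < ‖z‖ / C₁) : z ∈ chartDomain n δ := by
  have hζ0 : 0 < ‖ζ‖ := norm_pos_iff.2 hζ.1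
  have hs : ‖ζ‖⁻¹ • ζ ∈ coneSphere n :=
    ⟨(smul_mem_cone (inv_ne_zero hζ0.ne')).2 hζ, by
      rw [norm_smul, norm_inv, norm_norm, inv_mul_cancel₀ hζ0.ne']⟩
  refine ⟨‖ζ‖⁻¹, inv_pos.2 hζ0, (Metric.infDist_le_dist_of_mem hs).trans_lt ?_⟩
  rw [dist_eq_norm, ← smul_sub, norm_smul, norm_inv, norm_norm, norm_sub_rev, inv_mul_lt_iff₀ hζ0]
  have h1 : ‖z‖ ≤ ‖ζ‖ + ‖ζ - z‖ := by
    refine le_trans (le_of_eq ?_) (norm_sub_le _ _)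
    congr 1; abel
  have hC0 : 0 < C₁ := by linarith
  have h2 : ‖ζ - z‖ * C₁ < ‖z‖ := (lt_div_iff₀ hC0).1 hn
  have h3 : ‖ζ - z‖ * (C₁ - 1) < ‖ζ‖ := by linarith
  have h4 : 1 < δ * (C₁ - 1) := by
    have : 1 / δ < C₁ - 1 := by linarith
    rwa [div_lt_iff₀ hδ, mul_comm] at this
  have h5 : ‖ζ - z‖ ≤ δ * (‖ζ - z‖ * (C₁ - 1)) := by
    nlinarith [norm_nonneg (ζ - z)]
  nlinarith

theorem ChartChoice.admissible (hz : z ∈ chartDomain n δ) :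
    Admissible C₀ δ (P.fstIdx z) (P.sndIdx z) z := by
  obtain ⟨r, hr, u, hu, h1, h2⟩ := P.close_of_mem z hz
  exact ⟨r, hr, u, hu.2, h1, h2⟩

end Components

/-- `(1 + |z| / |ζ|)^α` for `i = 1`, and `1` otherwise. -/
def radialOne {k : ℕ} (i : ℕ) (α : ℝ) (z ζ : Cvec k) : ℝ≥0∞ := if i = 1 then radial α z ζ else 1

theorem measurable_radialOne {k : ℕ} (i : ℕ) (α : ℝ) (z : Cvec k) :
    Measurable (radialOne i α z) := by
  unfold radialOne
  split_ifs
  · exact measurable_radial α z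
  · exact measurable_const

theorem radial_le_radialOne {k k' : ℕ} {i : ℕ} {α : ℝ} (hα : 0 ≤ α) {z ζ : Cvec k}
    {z' ζ' : Cvec k'} (hz : ‖z'‖ = ‖z‖) (hζ : ‖ζ'‖ ≤ ‖ζ‖) (h : ‖z‖ ≤ 2 * ‖ζ‖) :
    radial α z ζ ≤ 3 ^ α * radialOne i α z' ζ' := by
  unfold radialOne
  split_ifs
  · refine (radial_le_radial hα hz.symm hζ).trans (le_mul_of_one_le_left zero_le ?_)
    rw [← ENNReal.one_rpow α]
    exact ENNReal.rpow_le_rpow (by norm_num) hα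
  · rw [mul_one]
    exact radial_le_of_norm_le hα h

section Regions

variable {k : ℕ} {C₀ C₁ C₂ a b : ℝ}

theorem exists_far_estimate (ha : 0 ≤ a) (hb0 : 0 ≤ b) (hb : b < 2) :
    ∃ A : NNReal, ∀ (i : ℕ) (z : Cvec (k + 1 + 1)) (z' : Cvec (k + 1)), ‖z'‖ = ‖z‖ →
      ∀ (F : Cvec (k + 1 + 1) → ℝ≥0∞) (G : Cvec (k + 1) → ℝ≥0∞), Measurable F → Measurable G →
      (∀ ζ ∈ cone (k + 1), Real.sqrt 2 * ‖z‖ < ‖ζ‖ → ∀ ζ', ‖ζ'‖ = ‖ζ‖ → F ζ ≤ G ζ') →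
      ∫⁻ ζ in {ζ | Real.sqrt 2 * ‖z‖ < ‖ζ‖}, F ζ * (radial a z ζ * angular b ζ)
        ∂coneMeasure (k + 1) ≤ A * ∫⁻ ζ', G ζ' * (radialOne i a z' ζ' * angular b ζ') := by
  obtain ⟨A, hA⟩ := exists_lintegral_coneMeasure_le (k := k) hb0 hb
  refine ⟨A * 3 ^ a, fun i z z' hz F G hF hG h => ?_⟩
  have hS : MeasurableSet {ζ : Cvec (k + 1 + 1) | Real.sqrt 2 * ‖z‖ < ‖ζ‖} :=
    measurableSet_lt measurable_const measurable_norm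
  set f := {ζ : Cvec (k + 1 + 1) | Real.sqrt 2 * ‖z‖ < ‖ζ‖}.indicator
    (fun ζ => F ζ * radial a z ζ) with hf
  set g := fun ζ' => (3 : ℝ≥0∞) ^ a * (G ζ' * radialOne i a z' ζ') with hg
  have hgm : Measurable fun ζ' => G ζ' * radialOne i a z' ζ' := hG.mul (measurable_radialOne i a z')
  have key := hA f g ((hF.mul (measurable_radial a z)).indicator hS) (hgm.const_mul _) ?_
  · rw [← lintegral_indicator hS]
    refine le_trans (lintegral_mono fun ζ => ?_) (key.trans ?_)
    · by_cases hζ : ζ ∈ {ζ : Cvec (k + 1 + 1) | Real.sqrt 2 * ‖z‖ < ‖ζ‖}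
      · simp only [hf, Set.indicator_of_mem hζ, mul_assoc]; exact le_rfl
      · simp [hf, Set.indicator_of_notMem hζ]
    · rw [hg, lintegral_const_mul _ hgm, ENNReal.coe_mul, mul_assoc]
      have : ((3 ^ a : NNReal) : ℝ≥0∞) = 3 ^ a := by
        rw [ENNReal.coe_rpow_of_nonneg _ ha]; rfl
      rw [this]
      refine mul_le_mul' le_rfl (mul_le_mul' le_rfl ?_)
      refine (lintegral_le_lintegral_mul_angular hb0 _).trans_eq ?_
      simp only [mul_assoc]
  · intro ζ hζ ζ' hζζ'
    refine Set.indicator_apply_le' (fun hm => ?_) fun _ => zero_le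
    have hm' : Real.sqrt 2 * ‖z‖ < ‖ζ‖ := hm
    have h1 := h ζ hζ hm ζ' hζζ'.symm
    have h2 : 1 ≤ Real.sqrt 2 := Real.one_le_sqrt.2 (by norm_num)
    have h3 := radial_le_radialOne (i := i) ha hz hζζ'.symm.le
      (by nlinarith [norm_nonneg z, norm_nonneg ζ])
    calc F ζ * radial a z ζ ≤ G ζ' * (3 ^ a * radialOne i a z' ζ') := mul_le_mul' h1 h3
      _ = _ := by rw [hg]; ring

theorem exists_near_estimate (hC₀ : 0 < C₀) (ha : 0 ≤ a) (hb0 : 0 ≤ b) :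
    ∃ A : NNReal, ∀ δ : ℝ, 18 * δ ≤ C₀ → δ ≤ 1 / 3 →
      ∀ (i : ℕ) (z : Cvec (k + 1 + 1)) (z' : Cvec (k + 1)), ‖z'‖ = ‖z‖ →
      ∀ p q : Fin (k + 1 + 1), p < q → Admissible C₀ δ p q z →
      ∀ (F : Cvec (k + 1 + 1) → ℝ≥0∞) (G : Cvec (k + 1) → ℝ≥0∞), Measurable G →
      ∀ r : ℝ, r ≤ δ * ‖z‖ →
      (∀ ζ ∈ cone (k + 1), ‖ζ - z‖ < r → F ζ ≤ G (chartMap p q z ζ)) →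
      ∫⁻ ζ in {ζ | ‖ζ - z‖ < r}, F ζ * (radial a z ζ * angular b ζ) ∂coneMeasure (k + 1) ≤
        A * ∫⁻ ζ', G ζ' * (radialOne i a z' ζ' * angular b ζ') := by
  set B : ℝ≥0∞ := 3 ^ a * ENNReal.ofReal (2 + 4 / C₀) ^ b with hB
  have hBt : B ≠ ∞ := ENNReal.mul_ne_top (ENNReal.rpow_ne_top_of_nonneg ha (by norm_num))
    (ENNReal.rpow_ne_top_of_nonneg hb0 ENNReal.ofReal_ne_top)
  refine ⟨chartConst (k + 1) C₀ ^ (2 * (k + 1)) * B.toNNReal,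
    fun δ hδC hδ3 i z z' hz p q hpq hadm F G hG r hr h => ?_⟩
  have hgm : Measurable fun ζ' => G ζ' * (radialOne i a z' ζ' * angular b ζ') :=
    hG.mul ((measurable_radialOne i a z').mul (measurable_angular b))
  have key := lintegral_chartMap_le hC₀ hδC hδ3 hpq.ne hadm (hgm.const_mul B)
  have hS : MeasurableSet {ζ : Cvec (k + 1 + 1) | ‖ζ - z‖ < r} :=
    measurableSet_lt (by fun_prop) measurable_const
  rw [lintegral_const_mul _ hgm] at key
  rw [ENNReal.coe_mul, ENNReal.coe_toNNReal hBt, ENNReal.coe_pow, mul_assoc]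
  refine le_trans ?_ key
  refine le_trans ?_ (lintegral_mono_set (fun ζ (hζ : ‖ζ - z‖ < r) => hζ.trans_le hr))
  refine lintegral_mono_ae ?_
  have hcone : ∀ᵐ ζ ∂(coneMeasure (k + 1)).restrict {ζ | ‖ζ - z‖ < r}, ζ ∈ cone (k + 1) :=
    ae_restrict_of_ae (ae_restrict_mem (measurableSet_cone _))
  filter_upwards [hcone, ae_restrict_mem hS] with ζ hζ hζr
  have hζδ : ‖ζ - z‖ < δ * ‖z‖ := lt_of_lt_of_le hζr hr
  have hzζ : ‖z‖ ≤ 2 * ‖ζ‖ := by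
    have h1 : ‖z‖ ≤ ‖ζ‖ + ‖ζ - z‖ := by
      refine le_trans (le_of_eq ?_) (norm_sub_le _ _)
      congr 1; abel
    nlinarith [norm_nonneg z]
  have h1 := radial_le_radialOne (i := i) ha hz (norm_chartMap_le hpq.ne z ζ) hzζ
  have h2 := angular_le_angular_chartMap hb0 hC₀ hδC hδ3 hpq hadm hζδ
  calc F ζ * (radial a z ζ * angular b ζ) ≤ G (chartMap p q z ζ) *
        ((3 ^ a * radialOne i a z' (chartMap p q z ζ)) *
          (ENNReal.ofReal (2 + 4 / C₀) ^ b * angular b (chartMap p q z ζ))) :=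
        mul_le_mul' (h ζ hζ hζr) (mul_le_mul' h1 h2)
    _ = _ := by rw [hB]; ring

/-- The shrinking factor used for points that are comparable, but not close, to the base point. -/
def shrink (C₂ : ℝ) : ℝ := (1 - 1 / C₂) / 2

theorem shrink_pos (hC₂ : 1 < C₂) : 0 < shrink C₂ := by
  have : 1 / C₂ < 1 := (div_lt_one (by linarith)).2 hC₂
  unfold shrink; linarith

theorem shrink_lt_half (hC₂ : 1 < C₂) : shrink C₂ < 1 / 2 := by
  have : 0 < 1 / C₂ := by positivity
  unfold shrink; linarith

theorem exists_middle_estimate_one (hC₂ : 1 < C₂) (ha : 0 ≤ a) (hb0 : 0 ≤ b) (hb : b < 2) :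
    ∃ A : NNReal, ∀ (z : Cvec (k + 1 + 1)) (z' : Cvec (k + 1)), ‖z'‖ = ‖z‖ →
      ∀ S : Set (Cvec (k + 1 + 1)), MeasurableSet S →
      ∀ (F : Cvec (k + 1 + 1) → ℝ≥0∞) (G : Cvec (k + 1) → ℝ≥0∞), Measurable F → Measurable G →
      (∀ ζ ∈ cone (k + 1), ζ ∈ S → ∀ ζ', ‖ζ'‖ = shrink C₂ * ‖ζ‖ → F ζ ≤ G ζ') →
      ∫⁻ ζ in S, F ζ * (radial a z ζ * angular b ζ) ∂coneMeasure (k + 1) ≤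
        A * ∫⁻ ζ', G ζ' * (radialOne 1 a z' ζ' * angular b ζ') := by
  obtain ⟨A, hA⟩ := exists_lintegral_coneMeasure_le (k := k) hb0 hb
  have hc0 := shrink_pos hC₂
  have hc1 := shrink_lt_half hC₂
  set c := shrink C₂
  have hcp : ENNReal.ofReal c ^ (2 * (k + 1)) ≠ 0 :=
    pow_ne_zero _ (ENNReal.ofReal_pos.2 hc0).ne'
  have hct : ENNReal.ofReal c ^ (2 * (k + 1)) ≠ ∞ := ENNReal.pow_ne_top ENNReal.ofReal_ne_top
  refine ⟨A * ((ENNReal.ofReal c ^ (2 * (k + 1)))⁻¹).toNNReal, fun z z' hz S hS F G hF hG h => ?_⟩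
  have hgm : Measurable fun ζ' => G ζ' * radial a z' ζ' := hG.mul (measurable_radial a z')
  have key := hA (S.indicator (fun ζ => F ζ * radial a z ζ))
    (fun y => G (c • y) * radial a z' (c • y)) ((hF.mul (measurable_radial a z)).indicator hS)
    (hgm.comp (continuous_const_smul c).measurable) ?_
  · rw [← lintegral_indicator hS]
    refine le_trans (lintegral_mono fun ζ => ?_) (key.trans ?_)
    · by_cases hζ : ζ ∈ S
      · simp only [Set.indicator_of_mem hζ, mul_assoc]; exact le_rfl
      · simp [Set.indicator_of_notMem hζ]
    · rw [ENNReal.coe_mul, mul_assoc, ENNReal.coe_toNNReal (ENNReal.inv_ne_top.2 hcp)]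
      refine mul_le_mul' le_rfl ?_
      have h1 := homogeneousMeasure_volume (k + 1) c hc0 _ hgm
      have h2 : ∫⁻ y, G (c • y) * radial a z' (c • y) =
          (ENNReal.ofReal c ^ (2 * (k + 1)))⁻¹ * ∫⁻ ζ', G ζ' * radial a z' ζ' := by
        rw [h1, ← mul_assoc, ENNReal.inv_mul_cancel hcp hct, one_mul]
      rw [h2]
      refine mul_le_mul' le_rfl ?_
      refine (lintegral_le_lintegral_mul_angular hb0 _).trans_eq ?_
      simp only [mul_assoc, radialOne, if_true]
  · intro ζ hζ y hy
    refine Set.indicator_apply_le' (fun hm => ?_) fun _ => zero_le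
    have hn : ‖c • y‖ = c * ‖ζ‖ := by rw [norm_smul, Real.norm_eq_abs, abs_of_pos hc0, hy]
    refine mul_le_mul' (h ζ hζ hm _ hn) (radial_le_radial ha hz.symm ?_)
    rw [hn]; nlinarith [norm_nonneg ζ]

theorem lintegral_radial_closedBall_lt_top (ha : 0 ≤ a) (hak : a < 2 * ((k + 1 : ℕ) : ℝ)) :
    ∫⁻ u in Metric.closedBall (0 : Cvec (k + 1)) (Real.sqrt 2), (1 + ‖u‖ₑ⁻¹) ^ a < ∞ := by
  have hd : Module.finrank ℝ (Cvec (k + 1)) = 2 * (k + 1) := finrank_cvec _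
  have h := setLIntegral_enorm_inv_rpow_lt_top (volume : Measure (Cvec (k + 1))) (β := a)
    (by omega) (by rw [hd]; exact_mod_cast hak) 2
  have hs : Real.sqrt 2 < 2 := by
    rw [Real.sqrt_lt' (by norm_num)]; norm_num
  refine lt_of_le_of_lt (b := ∫⁻ u in Metric.ball (0 : Cvec (k + 1)) 2, 3 ^ a * (‖u‖ₑ⁻¹) ^ a) ?_ ?_
  · refine (setLIntegral_mono' Metric.isClosed_closedBall.measurableSet fun u hu => ?_).trans
      (lintegral_mono_set (Metric.closedBall_subset_ball hs))
    rw [← ENNReal.mul_rpow_of_nonneg _ _ ha]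
    refine ENNReal.rpow_le_rpow ?_ ha
    have h1 : ‖u‖ₑ ≤ 2 := by
      have h2 : ‖u‖ ≤ Real.sqrt 2 := by simpa using hu
      have h3 := ENNReal.ofReal_le_ofReal (h2.trans hs.le)
      rwa [ofReal_norm, ENNReal.ofReal_ofNat] at h3
    have h2 : 1 ≤ 2 * ‖u‖ₑ⁻¹ := by
      rw [← div_eq_mul_inv]
      rcases eq_or_ne u 0 with rfl | h0
      · simp [ENNReal.div_zero]
      · exact (ENNReal.le_div_iff_mul_le (Or.inr (by simp)) (Or.inl enorm_ne_top)).2 (by simpa)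
    calc 1 + ‖u‖ₑ⁻¹ ≤ 2 * ‖u‖ₑ⁻¹ + ‖u‖ₑ⁻¹ := by gcongr
      _ = 3 * ‖u‖ₑ⁻¹ := by ring
  · rw [lintegral_const_mul (f := fun u : Cvec (k + 1) => (‖u‖ₑ⁻¹) ^ a) _
      (measurable_enorm.inv.pow_const a)]
    exact ENNReal.mul_lt_top (ENNReal.rpow_lt_top_of_nonneg ha (by norm_num)) h

theorem exists_middle_estimate_two (hC₂ : 1 < C₂) (ha : 0 ≤ a) (hak : a < 2 * ((k + 1 : ℕ) : ℝ))
    (hb0 : 0 ≤ b) (hb : b < 2) :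
    ∃ A : NNReal, ∀ (z : Cvec (k + 1 + 1)),
      ∀ S : Set (Cvec (k + 1 + 1)), MeasurableSet S →
      (∀ ζ ∈ S, ‖ζ‖ ≤ Real.sqrt 2 * ‖z‖) →
      ∀ (F : Cvec (k + 1 + 1) → ℝ≥0∞) (G : Cvec (k + 1) → ℝ≥0∞), Measurable G →
      (∀ ζ ∈ cone (k + 1), ζ ∈ S → ∀ ζ', ‖ζ'‖ ≤ shrink C₂ * ‖z‖ → F ζ ≤ G ζ') →
      ∫⁻ ζ in S, F ζ * (radial a z ζ * angular b ζ) ∂coneMeasure (k + 1) ≤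
        A * ∫⁻ ζ', G ζ' * angular b ζ' := by
  obtain ⟨A, hA⟩ := exists_lintegral_coneMeasure_le (k := k) hb0 hb
  have hc0 := shrink_pos hC₂
  set c := shrink C₂
  set J := ∫⁻ u in Metric.closedBall (0 : Cvec (k + 1)) (Real.sqrt 2), (1 + ‖u‖ₑ⁻¹) ^ a with hJ
  have hJt : J < ∞ := lintegral_radial_closedBall_lt_top ha hak
  set V := volume (Metric.closedBall (0 : Cvec (k + 1)) c) with hV
  have hV0 : V ≠ 0 := (Metric.measure_closedBall_pos volume 0 hc0).ne'
  have hVt : V ≠ ∞ := Metric.isBounded_closedBall.measure_lt_top.ne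
  have hJV : A * (J / V) ≠ ∞ :=
    ENNReal.mul_ne_top ENNReal.coe_ne_top (ENNReal.div_lt_top hJt.ne hV0).ne
  refine ⟨(A * (J / V)).toNNReal, fun z S hS hSz F G hG h => ?_⟩
  rw [ENNReal.coe_toNNReal hJV]
  have hcone : ∀ᵐ ζ ∂(coneMeasure (k + 1)).restrict S, ζ ∈ cone (k + 1) :=
    ae_restrict_of_ae (ae_restrict_mem (measurableSet_cone _))
  rcases eq_or_ne z 0 with rfl | hz
  · have h0 : ∫⁻ ζ in S, F ζ * (radial a 0 ζ * angular b ζ) ∂coneMeasure (k + 1) ≤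
        ∫⁻ ζ in S, 0 ∂coneMeasure (k + 1) := by
      refine lintegral_mono_ae ?_
      filter_upwards [hcone, ae_restrict_mem hS] with ζ hζ hζS
      have := hSz ζ hζS
      rw [norm_zero, mul_zero] at this
      exact absurd (norm_le_zero_iff.1 this) hζ.1
    refine h0.trans ?_
    simp
  have hz0 : 0 < ‖z‖ := norm_pos_iff.2 hz
  set T := ENNReal.ofReal ‖z‖ ^ (2 * (k + 1)) with hT
  set g₀ : ℝ≥0∞ := ⨅ ζ' ∈ Metric.closedBall (0 : Cvec (k + 1)) (c * ‖z‖), G ζ' with hg₀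
  -- the weighted volume of the ball of radius `√2 |z|`
  set ρ : Cvec (k + 1) → ℝ≥0∞ :=
    (Metric.closedBall (0 : Cvec (k + 1)) (Real.sqrt 2 * ‖z‖)).indicator
      fun y => (1 + ‖z‖ₑ / ‖y‖ₑ) ^ a with hρ
  have hρm : Measurable ρ :=
    ((measurable_const.add (measurable_const.div measurable_enorm)).pow_const a).indicator
      Metric.isClosed_closedBall.measurableSet
  have h1 : ∫⁻ ζ in S, radial a z ζ * angular b ζ ∂coneMeasure (k + 1) ≤ A * ∫⁻ y, ρ y := by
    have key := hA (S.indicator (radial a z)) ρ ((measurable_radial a z).indicator hS) hρm ?_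
    · rw [← lintegral_indicator hS]
      refine le_trans (lintegral_mono fun ζ => ?_) key
      by_cases hζ : ζ ∈ S
      · simp only [Set.indicator_of_mem hζ]; exact le_rfl
      · simp [Set.indicator_of_notMem hζ]
    · intro ζ _ y hy
      refine Set.indicator_apply_le' (fun hm => ?_) fun _ => zero_le
      have hyb : y ∈ Metric.closedBall (0 : Cvec (k + 1)) (Real.sqrt 2 * ‖z‖) := by
        rw [mem_closedBall_zero_iff, ← hy]; exact hSz ζ hm
      rw [hρ, Set.indicator_of_mem hyb, radial, ← ofReal_norm ζ, hy, ofReal_norm]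
  have h2 : ∫⁻ y, ρ y = T * J := by
    rw [homogeneousMeasure_volume (k + 1) _ hz0 ρ hρm, hJ,
      ← lintegral_indicator Metric.isClosed_closedBall.measurableSet]
    congr 1
    refine lintegral_congr fun u => ?_
    have hiff : ‖z‖ • u ∈ Metric.closedBall (0 : Cvec (k + 1)) (Real.sqrt 2 * ‖z‖) ↔
        u ∈ Metric.closedBall (0 : Cvec (k + 1)) (Real.sqrt 2) := by
      rw [mem_closedBall_zero_iff, mem_closedBall_zero_iff, norm_smul, norm_norm, mul_comm,
        mul_le_mul_iff_left₀ hz0]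
    by_cases hu : u ∈ Metric.closedBall (0 : Cvec (k + 1)) (Real.sqrt 2)
    · rw [hρ, Set.indicator_of_mem (hiff.2 hu), Set.indicator_of_mem hu, enorm_smul, enorm_norm]
      congr 2
      have hz1 : ‖z‖ₑ ≠ 0 := by simpa using hz
      have := ENNReal.mul_div_mul_left 1 ‖u‖ₑ hz1 enorm_ne_top
      rwa [mul_one, one_div] at this
    · rw [hρ, Set.indicator_of_notMem (fun h => hu (hiff.1 h)), Set.indicator_of_notMem hu]
  have h3 : g₀ * (T * V) ≤ ∫⁻ ζ', G ζ' * angular b ζ' := by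
    have hVz : volume (Metric.closedBall (0 : Cvec (k + 1)) (c * ‖z‖)) = T * V := by
      rw [hV, hT, mul_comm c, Measure.addHaar_closedBall_mul volume 0 hz0.le hc0.le, finrank_cvec,
        ENNReal.ofReal_pow hz0.le]
    rw [← hVz, ← setLIntegral_const]
    refine le_trans ?_ (lintegral_le_lintegral_mul_angular hb0 G)
    refine le_trans (setLIntegral_mono' Metric.isClosed_closedBall.measurableSet fun ζ' hζ' => ?_)
      (setLIntegral_le_lintegral _ _)
    exact iInf₂_le ζ' hζ'
  have h4 : ∫⁻ ζ in S, F ζ * (radial a z ζ * angular b ζ) ∂coneMeasure (k + 1) ≤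
      g₀ * ∫⁻ ζ in S, radial a z ζ * angular b ζ ∂coneMeasure (k + 1) := by
    rw [← lintegral_const_mul (f := fun ζ => radial a z ζ * angular b ζ) _
      ((measurable_radial a z).mul (measurable_angular b))]
    refine lintegral_mono_ae ?_
    filter_upwards [hcone, ae_restrict_mem hS] with ζ hζ hζS
    refine mul_le_mul' ?_ le_rfl
    exact le_iInf₂ fun ζ' hζ' => h ζ hζ hζS ζ' (by simpa using hζ')
  calc _ ≤ g₀ * (A * (T * J)) := h4.trans (mul_le_mul' le_rfl (h1.trans_eq (by rw [h2])))
    _ = A * (J / V) * (g₀ * (T * V)) := by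
        have : J = J / V * V := (ENNReal.div_mul_cancel hV0 hVt).symm
        conv_lhs => rw [this]
        ring
    _ ≤ _ := by gcongr

end Regions

theorem exists_factor_estimate {n : ℕ} (hn : 1 ≤ n) {C₀ C₁ C₂ a b : ℝ} (hC₀ : 0 < C₀)
    (hC₁ : 1 < C₁) (hC₂ : 1 < C₂) (ha : 0 ≤ a) (han : a < 2 * (n : ℝ)) (hb0 : 0 ≤ b) (hb : b < 2) :
    ∃ A : NNReal, ∀ δ : ℝ, 0 < δ → 18 * δ ≤ C₀ → δ ≤ 1 / 4 → 1 / δ + 1 < C₁ →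
      ∀ (P : ChartChoice n C₀ δ) (i : ℕ), (i = 1 ∨ i = 2) →
      ∀ (z : Cvec (n + 1)) (z' : Cvec n), CompBase P C₁ z z' →
      ∀ (F : Cvec (n + 1) → ℝ≥0∞) (G : Cvec n → ℝ≥0∞), Measurable F → Measurable G →
      (∀ ζ ζ', CompPoint P C₁ C₂ i z z' ζ ζ' → F ζ ≤ G ζ') →
      ∫⁻ ζ, F ζ * (radial a z ζ * angular b ζ) ∂coneMeasure n ≤
        A * ∫⁻ ζ', G ζ' * (radialOne i a z' ζ' * angular b ζ') := by
  obtain ⟨k, rfl⟩ : ∃ k, n = k + 1 := ⟨n - 1, by omega⟩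
  obtain ⟨A₁, hA₁⟩ := exists_far_estimate (k := k) ha hb0 hb
  obtain ⟨A₂, hA₂⟩ := exists_near_estimate (k := k) hC₀ ha hb0
  obtain ⟨A₃, hA₃⟩ := exists_middle_estimate_one (k := k) hC₂ ha hb0 hb
  obtain ⟨A₄, hA₄⟩ := exists_middle_estimate_two (k := k) hC₂ ha han hb0 hb
  refine ⟨A₁ + (A₂ + (A₃ + A₄)), fun δ hδ hδC hδ4 hδC₁ P i hi z z' hzz' F G hF hG h => ?_⟩
  set I := ∫⁻ ζ', G ζ' * (radialOne i a z' ζ' * angular b ζ') with hI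
  have hnorm : ‖z'‖ = ‖z‖ := hzz'.norm_eq
  have hC₁pos : 0 < C₁ := by linarith
  have hC₁inv : ‖z‖ / C₁ ≤ δ * ‖z‖ := by
    have h1 : 1 / δ < C₁ := by linarith
    rw [div_lt_iff₀ hδ] at h1
    rw [div_le_iff₀ hC₁pos]
    nlinarith [norm_nonneg z]
  have hsq : 5 / 4 < Real.sqrt 2 := Real.lt_sqrt_of_sq_lt (by norm_num)
  have hsq2 : Real.sqrt 2 < 2 := by
    rw [Real.sqrt_lt' (by norm_num)]; norm_num
  have hdisj : ∀ ζ : Cvec (k + 1 + 1), ‖ζ - z‖ < ‖z‖ / C₁ → ¬ Real.sqrt 2 * ‖z‖ < ‖ζ‖ := by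
    intro ζ h1 h2
    have h3 : ‖ζ‖ ≤ ‖ζ - z‖ + ‖z‖ := by
      refine le_trans (le_of_eq ?_) (norm_add_le _ _)
      congr 1; abel
    nlinarith [norm_nonneg z]
  set far : Set (Cvec (k + 1 + 1)) := {ζ | Real.sqrt 2 * ‖z‖ < ‖ζ‖} with hfar
  set near : Set (Cvec (k + 1 + 1)) := {ζ | ‖ζ - z‖ < ‖z‖ / C₁} with hnear
  set mid : Set (Cvec (k + 1 + 1)) :=
    {ζ | ‖ζ‖ ≤ Real.sqrt 2 * ‖z‖} ∩ {ζ | ‖z‖ / C₁ ≤ ‖ζ - z‖} with hmid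
  have hmidm : MeasurableSet mid :=
    (measurableSet_le measurable_norm measurable_const).inter
      (measurableSet_le measurable_const (by fun_prop))
  have hmidC : ∀ ζ ∈ cone (k + 1), ζ ∈ mid → ∀ ζ',
      ‖ζ'‖ < 2 * shrink C₂ * ‖z‖ → (i = 1 → ‖ζ'‖ ≤ ‖ζ‖) → F ζ ≤ G ζ' := by
    intro ζ hζ hm ζ' h2 h3
    have hc := shrink_lt_half hC₂
    refine h ζ ζ' ⟨hζ, fun h => absurd h (not_lt.2 hm.1), fun h => absurd h (not_lt.2 hm.2),
      fun _ => ⟨?_, ?_, h3⟩⟩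
    · rw [hnorm]; nlinarith [norm_nonneg z]
    · have h4 : ‖z'‖ ≤ ‖ζ'‖ + ‖ζ' - z'‖ := by
        refine le_trans (le_of_eq ?_) (norm_sub_le _ _)
        congr 1; abel
      have h5 : ‖z'‖ / C₂ = ‖z‖ - 2 * shrink C₂ * ‖z‖ := by
        rw [shrink, hnorm]; ring
      rw [hnorm] at h4
      linarith
  have h1 : ∫⁻ ζ in far, F ζ * (radial a z ζ * angular b ζ) ∂coneMeasure (k + 1) ≤ A₁ * I :=
    hA₁ i z z' hnorm F G hF hG fun ζ hζ hf ζ' hn => h ζ ζ'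
      ⟨hζ, fun _ => hn, fun hh => absurd hf (hdisj ζ hh), fun hh => absurd hf (not_lt.2 hh.1)⟩
  have h2 : ∫⁻ ζ in near, F ζ * (radial a z ζ * angular b ζ) ∂coneMeasure (k + 1) ≤ A₂ * I := by
    by_cases hz : z ∈ chartDomain (k + 1) δ
    · exact hA₂ δ hδC (by linarith) i z z' hnorm _ _ (P.lt_of_mem z hz) (ChartChoice.admissible hz) F G hG
        _ hC₁inv fun ζ hζ hn => h ζ _ ⟨hζ, fun hh => absurd hh (hdisj ζ hn), fun _ => rfl,
          fun hh => absurd hn (not_lt.2 hh.2)⟩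
    · have h0 : ∫⁻ ζ in near, F ζ * (radial a z ζ * angular b ζ) ∂coneMeasure (k + 1) ≤
          ∫⁻ ζ in near, 0 ∂coneMeasure (k + 1) := by
        refine lintegral_mono_ae ?_
        have hcone : ∀ᵐ ζ ∂(coneMeasure (k + 1)).restrict near, ζ ∈ cone (k + 1) :=
          ae_restrict_of_ae (ae_restrict_mem (measurableSet_cone _))
        have hnm : MeasurableSet near := measurableSet_lt (by fun_prop) measurable_const
        filter_upwards [hcone, ae_restrict_mem hnm] with ζ hζ hζn
        exact absurd (mem_chartDomain_of_near hC₁ hδ hδC₁ hζ hζn) hz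
      exact h0.trans (by simp)
  have h3 : ∫⁻ ζ in mid, F ζ * (radial a z ζ * angular b ζ) ∂coneMeasure (k + 1) ≤
      (A₃ + A₄ : ℝ≥0∞) * I := by
    have hc0 := shrink_pos hC₂
    rcases hi with rfl | rfl
    · refine (hA₃ z z' hnorm mid hmidm F G hF hG fun ζ hζ hm ζ' hn => ?_).trans
        (mul_le_mul' le_self_add le_rfl)
      have hζ0 : 0 < ‖ζ‖ := norm_pos_iff.2 hζ.1
      have hζz : ‖ζ‖ ≤ Real.sqrt 2 * ‖z‖ := hm.1
      have hz0 : 0 < ‖z‖ := by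
        by_contra hcon
        nlinarith [norm_nonneg z]
      have hlt : ‖ζ‖ < 2 * ‖z‖ := by nlinarith
      have hc := shrink_lt_half hC₂
      exact hmidC ζ hζ hm ζ' (by nlinarith) fun _ => by nlinarith
    · refine (hA₄ z mid hmidm (fun ζ hm => hm.1) F G hG fun ζ hζ hm ζ' hn => ?_).trans ?_
      · have hζ0 : 0 < ‖ζ‖ := norm_pos_iff.2 hζ.1
        have hζz : ‖ζ‖ ≤ Real.sqrt 2 * ‖z‖ := hm.1
        have hz0 : 0 < ‖z‖ := by
          by_contra hcon
          nlinarith [norm_nonneg z]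
        have := mul_pos hc0 hz0
        exact hmidC ζ hζ hm ζ' (by nlinarith) fun h => by omega
      · refine mul_le_mul' le_add_self (le_of_eq ?_)
        simp [hI, radialOne]
  have hcover : (Set.univ : Set (Cvec (k + 1 + 1))) ⊆ far ∪ (near ∪ mid) := by
    intro ζ _
    by_cases hf : Real.sqrt 2 * ‖z‖ < ‖ζ‖
    · exact Or.inl hf
    by_cases hn : ‖ζ - z‖ < ‖z‖ / C₁
    · exact Or.inr (Or.inl hn)
    · exact Or.inr (Or.inr ⟨not_lt.1 hf, not_lt.1 hn⟩)
  calc ∫⁻ ζ, F ζ * (radial a z ζ * angular b ζ) ∂coneMeasure (k + 1)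
      = ∫⁻ ζ in Set.univ, F ζ * (radial a z ζ * angular b ζ) ∂coneMeasure (k + 1) := by
        rw [Measure.restrict_univ]
    _ ≤ ∫⁻ ζ in far ∪ (near ∪ mid), F ζ * (radial a z ζ * angular b ζ) ∂coneMeasure (k + 1) :=
        lintegral_mono_set hcover
    _ ≤ A₁ * I + (A₂ * I + (A₃ + A₄ : ℝ≥0∞) * I) :=
        (lintegral_union_le _ _ _).trans
          (add_le_add h1 ((lintegral_union_le _ _ _).trans (add_le_add h2 h3)))
    _ = _ := by push_cast; ring

/-! ### Comparison of `dV` with a product measure -/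

theorem restrict_iUnion_le_of_forall {X ι : Type*} [MeasurableSpace X] [Countable ι]
    {μ ν : Measure X} {V : ι → Set X} (hV : ∀ i, MeasurableSet (V i))
    (h : ∀ i, ∀ s ⊆ V i, MeasurableSet s → μ s ≤ ν s) : μ.restrict (⋃ i, V i) ≤ ν := by
  rcases isEmpty_or_nonempty ι with hι | hι
  · simp only [Set.iUnion_of_empty, Measure.restrict_empty]
    exact Measure.zero_le _
  obtain ⟨e, he⟩ := exists_surjective_nat ι
  have hU : ⋃ i, V i = ⋃ k, disjointed (fun k => V (e k)) k := by
    rw [iUnion_disjointed, he.iUnion_comp]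
  have hd : ∀ k, MeasurableSet (disjointed (fun k => V (e k)) k) :=
    MeasurableSet.disjointed fun k => hV (e k)
  have hdisj := disjoint_disjointed fun k => V (e k)
  refine Measure.le_intro fun s hs _ => ?_
  rw [Measure.restrict_apply hs, hU, Set.inter_iUnion]
  calc μ (⋃ k, s ∩ disjointed (fun k => V (e k)) k)
      ≤ ∑' k, μ (s ∩ disjointed (fun k => V (e k)) k) := measure_iUnion_le _
    _ ≤ ∑' k, ν (s ∩ disjointed (fun k => V (e k)) k) :=
        ENNReal.tsum_le_tsum fun k => h (e k) _
          (Set.inter_subset_right.trans (disjointed_subset _ k)) (hs.inter (hd k))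
    _ = ν (⋃ k, s ∩ disjointed (fun k => V (e k)) k) :=
        (measure_iUnion (fun a b hab => (hdisj hab).mono Set.inter_subset_right
          Set.inter_subset_right) fun k => hs.inter (hd k)).symm
    _ ≤ ν s := measure_mono (Set.iUnion_subset fun k => Set.inter_subset_left)

/-- The components of a point of `ℂᵃ⁺ᵇ⁺ᶜ`. -/
def tripleEquiv (a b c : ℕ) : Triple a b c ≃ᵐ Cvec a × Cvec b × Cvec c :=
  (MeasurableEquiv.toLp 2 (Cvec a × WithLp 2 (Cvec b × Cvec c))).symm.trans
    (MeasurableEquiv.prodCongr (MeasurableEquiv.refl _)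
      (MeasurableEquiv.toLp 2 (Cvec b × Cvec c)).symm)

@[simp]
theorem tripleEquiv_apply {a b c : ℕ} (Θ : Triple a b c) :
    tripleEquiv a b c Θ = (Θ.fst, Θ.snd.fst, Θ.snd.snd) := rfl

theorem measurePreserving_tripleEquiv (a b c : ℕ) :
    MeasurePreserving (tripleEquiv a b c) volume (volume.prod (volume.prod volume)) := by
  have h1 : MeasurePreserving (MeasurableEquiv.toLp 2 (Cvec a × WithLp 2 (Cvec b × Cvec c))).symm
      volume (volume.prod volume) :=
    WithLp.volume_preserving_symm_measurableEquiv_toLp_prod _ _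
  have h2 : MeasurePreserving (MeasurableEquiv.toLp 2 (Cvec b × Cvec c)).symm
      volume (volume.prod volume) :=
    WithLp.volume_preserving_symm_measurableEquiv_toLp_prod _ _
  exact ((MeasurePreserving.id volume).prod h2).comp h1

theorem finrank_triple (a b c : ℕ) : Module.finrank ℝ (Triple a b c) = 2 * (a + b + c) := by
  have h1 := (WithLp.linearEquiv 2 ℝ (Cvec a × WithLp 2 (Cvec b × Cvec c))).finrank_eq
  have h2 := (WithLp.linearEquiv 2 ℝ (Cvec b × Cvec c)).finrank_eq
  rw [h1, Module.finrank_prod, h2, Module.finrank_prod, finrank_cvec, finrank_cvec, finrank_cvec]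
  ring

theorem euclideanHausdorffMeasure_triple (a b c : ℕ) :
    (μHE[2 * (a + b + c)] : Measure (Triple a b c)) = volume := by
  rw [← finrank_triple a b c]
  exact InnerProductSpace.euclideanHausdorffMeasure_eq_volume

theorem volume_restrict_image_le {n : ℕ} {f : Cvec (n + 1) → Cvec n} (hf : Measurable f)
    {U : Set (Cvec (n + 1))} (hU : U ⊆ cone n) (hLip : ∀ x y, dist (f x) (f y) ≤ dist x y) :
    volume.restrict (f '' U) ≤ ((coneMeasure n).restrict U).map f := by
  refine Measure.le_intro fun B hB _ => ?_
  rw [Measure.restrict_apply hB, Measure.map_apply hf hB, Measure.restrict_apply (hf hB), coneMeasure,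
    Measure.restrict_apply' (measurableSet_cone n), ← euclideanHausdorffMeasure_cvec]
  have hL : LipschitzOnWith 1 f (f ⁻¹' B ∩ U ∩ cone n) :=
    (LipschitzWith.of_dist_le_mul (K := 1) fun x y => by simpa using hLip x y).lipschitzOnWith
  have h := euclideanHausdorffMeasure_image_le (d := 2 * n) hL
  rw [ENNReal.coe_one, one_pow, one_mul] at h
  refine (measure_mono ?_).trans h
  rintro _ ⟨hx, x, hxU, rfl⟩
  exact ⟨x, ⟨⟨hx, hxU⟩, hU hxU⟩, rfl⟩

/-- The product of Lebesgue measure and the canonical measures of the two cones. -/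
def productMeasure (l n m : ℕ) : Measure (Cvec l × Cvec (n + 1) × Cvec (m + 1)) :=
  volume.prod ((coneMeasure n).prod (coneMeasure m))

section Local

variable {l n m : ℕ} {f : Cvec (n + 1) → Cvec n} {g : Cvec (m + 1) → Cvec m}
  {U : Set (Cvec (n + 1))} {V : Set (Cvec (m + 1))}

theorem dist_sq_triple {a b c : ℕ} (Θ Θ' : Triple a b c) : dist Θ Θ' ^ 2 =
    dist Θ.fst Θ'.fst ^ 2 + dist Θ.snd.fst Θ'.snd.fst ^ 2 + dist Θ.snd.snd Θ'.snd.snd ^ 2 := by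
  rw [WithLp.prod_dist_eq_of_L2, Real.sq_sqrt (by positivity), WithLp.prod_dist_eq_of_L2,
    Real.sq_sqrt (by positivity), add_assoc]

theorem euclideanHausdorffMeasure_le_productMeasure (hn : 1 ≤ n) (hm : 1 ≤ m)
    (hf : Continuous f) (hg : Continuous g)
    (hU : U ⊆ cone n) (hV : V ⊆ cone m)
    (hfL : ∀ x y, dist (f x) (f y) ≤ dist x y) (hgL : ∀ x y, dist (g x) (g y) ≤ dist x y)
    {K : NNReal} (hK : 1 ≤ K)
    (hfK : ∀ x ∈ U, ∀ y ∈ U, dist x y ≤ K * dist (f x) (f y))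
    (hgK : ∀ x ∈ V, ∀ y ∈ V, dist x y ≤ K * dist (g x) (g y))
    {A : Set (Triple l (n + 1) (m + 1))} (hA : MeasurableSet A)
    (hAU : ∀ Θ ∈ A, Θ.snd.fst ∈ U ∧ Θ.snd.snd ∈ V) :
    (μHE[2 * (l + n + m)] : Measure (Triple l (n + 1) (m + 1))) A ≤
      (K : ℝ≥0∞) ^ (2 * (l + n + m)) *
        (productMeasure l n m).map (tripleEquiv l (n + 1) (m + 1)).symm A := by
  have hσn := sigmaFinite_coneMeasure hn
  have hσm := sigmaFinite_coneMeasure hm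
  set τ := tripleEquiv l (n + 1) (m + 1) with hτ
  set Ψ : Cvec l × Cvec (n + 1) × Cvec (m + 1) → Cvec l × Cvec n × Cvec m :=
    Prod.map id (Prod.map f g) with hΨ
  have hΨc : Continuous Ψ := continuous_id.prodMap (hf.prodMap hg)
  set F : Triple l (n + 1) (m + 1) → Triple l n m :=
    fun Θ => (tripleEquiv l n m).symm (Ψ (τ Θ)) with hF
  have hexp : ∀ Θ ∈ A, ∀ Θ' ∈ A, dist Θ Θ' ≤ K * dist (F Θ) (F Θ') := by
    intro Θ hΘ Θ' hΘ'
    rw [← sq_le_sq₀ dist_nonneg (by positivity), mul_pow, dist_sq_triple, dist_sq_triple]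
    have hK' : (1 : ℝ) ≤ K := by exact_mod_cast hK
    have h1 : dist Θ.fst Θ'.fst ≤ K * dist Θ.fst Θ'.fst := le_mul_of_one_le_left dist_nonneg hK'
    have h2 := hfK _ (hAU Θ hΘ).1 _ (hAU Θ' hΘ').1
    have h3 := hgK _ (hAU Θ hΘ).2 _ (hAU Θ' hΘ').2
    have h1' := pow_le_pow_left₀ dist_nonneg h1 2
    have h2' := pow_le_pow_left₀ dist_nonneg h2 2
    have h3' := pow_le_pow_left₀ dist_nonneg h3 2
    rw [mul_pow] at h1' h2' h3'
    have e1 : dist (F Θ).fst (F Θ').fst = dist Θ.fst Θ'.fst := rfl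
    have e2 : dist (F Θ).snd.fst (F Θ').snd.fst = dist (f Θ.snd.fst) (f Θ'.snd.fst) := rfl
    have e3 : dist (F Θ).snd.snd (F Θ').snd.snd = dist (g Θ.snd.snd) (g Θ'.snd.snd) := rfl
    rw [e1, e2, e3]
    linarith
  refine (euclideanHausdorffMeasure_le_image hexp).trans (mul_le_mul' le_rfl ?_)
  rw [euclideanHausdorffMeasure_triple, Measure.map_apply τ.symm.measurable hA]
  set A' := τ.symm ⁻¹' A with hA'
  have hA'm : MeasurableSet A' := τ.symm.measurable hA
  set W : Set (Cvec l × Cvec (n + 1) × Cvec (m + 1)) := Set.univ ×ˢ (U ×ˢ V) with hW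
  have hA'W : A' ⊆ W := by
    intro p hp
    have := hAU _ hp
    exact ⟨trivial, this.1, this.2⟩
  have hfi : Set.InjOn f U := fun x hx y hy hxy => by
    have := hfK x hx y hy
    rw [hxy, dist_self, mul_zero] at this
    exact dist_le_zero.1 this
  have hgi : Set.InjOn g V := fun x hx y hy hxy => by
    have := hgK x hx y hy
    rw [hxy, dist_self, mul_zero] at this
    exact dist_le_zero.1 this
  have hΨi : Set.InjOn Ψ W := by
    rintro ⟨x, y, z⟩ ⟨-, hy, hz⟩ ⟨x', y', z'⟩ ⟨-, hy', hz'⟩ h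
    simp only [hΨ, Prod.map_apply, id, Prod.mk.injEq] at h
    have e1 : y = y' := hfi hy hy' h.2.1
    have e2 : z = z' := hgi hz hz' h.2.2
    rw [h.1, e1, e2]
  have hB : MeasurableSet (Ψ '' A') :=
    hA'm.image_of_continuousOn_injOn hΨc.continuousOn (hΨi.mono hA'W)
  have hFA : F '' A = tripleEquiv l n m ⁻¹' (Ψ '' A') := by
    ext Θ'
    constructor
    · rintro ⟨Θ, hΘ, rfl⟩
      refine ⟨τ Θ, ?_, ?_⟩
      · simpa [hA'] using hΘ
      · simp only [hF, MeasurableEquiv.apply_symm_apply]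
    · rintro ⟨p, hp, hpΘ⟩
      refine ⟨τ.symm p, hp, ?_⟩
      simp only [hF, MeasurableEquiv.apply_symm_apply]
      rw [hpΘ, MeasurableEquiv.symm_apply_apply]
  rw [hFA, (measurePreserving_tripleEquiv l n m).measure_preimage hB.nullMeasurableSet]
  have hsub : Ψ '' A' ⊆ Set.univ ×ˢ ((f '' U) ×ˢ (g '' V)) := by
    rintro _ ⟨p, hp, rfl⟩
    have := hA'W hp
    exact ⟨trivial, ⟨_, this.2.1, rfl⟩, ⟨_, this.2.2, rfl⟩⟩
  calc (volume.prod (volume.prod volume)) (Ψ '' A')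
      = ((volume.restrict Set.univ).prod ((volume.restrict (f '' U)).prod
          (volume.restrict (g '' V)))) (Ψ '' A') := by
        rw [Measure.prod_restrict, Measure.prod_restrict, Measure.restrict_apply hB,
          Set.inter_eq_self_of_subset_left hsub]
    _ ≤ (((volume : Measure (Cvec l)).map id).prod ((((coneMeasure n).restrict U).map f).prod
          (((coneMeasure m).restrict V).map g))) (Ψ '' A') := by
        refine Measure.prod_mono ?_ (Measure.prod_mono ?_ ?_) _
        · rw [Measure.restrict_univ, Measure.map_id]
        · exact volume_restrict_image_le hf.measurable hU hfL
        · exact volume_restrict_image_le hg.measurable hV hgL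
    _ = ((productMeasure l n m).restrict W).map Ψ (Ψ '' A') := by
        rw [Measure.map_prod_map _ _ hf.measurable hg.measurable,
          Measure.map_prod_map _ _ measurable_id (hf.measurable.prodMap hg.measurable),
          productMeasure, hW, ← Measure.prod_restrict, ← Measure.prod_restrict,
          Measure.restrict_univ]
    _ = productMeasure l n m (Ψ ⁻¹' (Ψ '' A') ∩ W) := by
        rw [Measure.map_apply hΨc.measurable hB, Measure.restrict_apply (hΨc.measurable hB)]
    _ ≤ productMeasure l n m A' := by
        refine measure_mono ?_
        rintro p ⟨⟨q, hq, hqp⟩, hp⟩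
        rwa [← hΨi (hA'W hq) hp hqp]

end Local

theorem exists_countable_patches (n : ℕ) : ∃ t : Set (Cvec (n + 1)), t.Countable ∧ t ⊆ cone n ∧
    cone n ⊆ ⋃ z ∈ t, {ζ | ‖ζ - z‖ < coneRadius n * ‖z‖} := by
  obtain ⟨t, hts, htc, ht⟩ := TopologicalSpace.countable_cover_nhdsWithin (s := cone n)
    (f := fun z => {ζ | ‖ζ - z‖ < coneRadius n * ‖z‖}) fun z hz => by
      refine mem_nhdsWithin_of_mem_nhds ((isOpen_lt (by fun_prop) continuous_const).mem_nhds ?_)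
      simpa using mul_pos (coneRadius_pos n) (norm_pos_iff.2 hz.1)
  exact ⟨t, htc, hts, ht⟩

theorem exists_dV_le (l : ℕ) {n m : ℕ} (hn : 1 ≤ n) (hm : 1 ≤ m) : ∃ A : NNReal,
    dV l n m ≤ (A : ℝ≥0∞) • (productMeasure l n m).map (tripleEquiv l (n + 1) (m + 1)).symm := by
  set K : NNReal := max 1 (max (chartConst n (1 / (2 * ((n : ℝ) + 1))))
    (chartConst m (1 / (2 * ((m : ℝ) + 1))))) with hK
  refine ⟨K ^ (2 * (l + n + m)), ?_⟩
  obtain ⟨t, htc, htn, ht⟩ := exists_countable_patches n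
  obtain ⟨u, huc, hum, hu⟩ := exists_countable_patches m
  have : Countable t := htc
  have : Countable u := huc
  set U : ∀ (k : ℕ), Cvec (k + 1) → Set (Cvec (k + 1)) := fun k z =>
    cone k ∩ {ζ | ‖ζ - z‖ < coneRadius k * ‖z‖} with hUdef
  have hUm : ∀ k z, MeasurableSet (U k z) := fun k z =>
    (measurableSet_cone k).inter (measurableSet_lt (by fun_prop) measurable_const)
  set V : t × u → Set (Triple l (n + 1) (m + 1)) := fun p =>
    {Θ | Θ.snd.fst ∈ U n p.1 ∧ Θ.snd.snd ∈ U m p.2} with hVdef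
  have hVm : ∀ p, MeasurableSet (V p) := fun p =>
    (tripleEquiv l (n + 1) (m + 1)).measurable
      (MeasurableSet.univ.prod ((hUm n p.1).prod (hUm m p.2))) |>.congr (by
        ext Θ; simp [hVdef])
  have hcov : manifoldH l n m ⊆ ⋃ p, V p := by
    intro Θ hΘ
    obtain ⟨z, hz, h1⟩ := Set.mem_iUnion₂.1 (ht hΘ.1)
    obtain ⟨w, hw, h2⟩ := Set.mem_iUnion₂.1 (hu hΘ.2)
    exact Set.mem_iUnion.2 ⟨(⟨z, hz⟩, ⟨w, hw⟩), ⟨hΘ.1, h1⟩, ⟨hΘ.2, h2⟩⟩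
  refine (Measure.restrict_mono_set _ hcov).trans (restrict_iUnion_le_of_forall hVm ?_)
  rintro ⟨⟨z, hz⟩, ⟨w, hw⟩⟩ s hs hsm
  obtain ⟨j, k, hjk, hadm⟩ := exists_admissible_of_mem_cone (htn hz) (coneRadius_pos n)
  obtain ⟨j', k', hjk', hadm'⟩ := exists_admissible_of_mem_cone (hum hw) (coneRadius_pos m)
  rw [Measure.smul_apply, smul_eq_mul, ENNReal.coe_pow]
  have hLip : ∀ {k : ℕ} {p q : Fin (k + 1)}, p ≠ q → ∀ z x y : Cvec (k + 1),
      dist (chartMap p q z x) (chartMap p q z y) ≤ dist x y := by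
    intro k p q hpq z x y
    rw [dist_eq_norm, dist_eq_norm, ← chartMap_sub]
    exact norm_chartMap_le hpq z _
  refine euclideanHausdorffMeasure_le_productMeasure (U := U n z) (V := U m w)
    (f := chartMap j k z) (g := chartMap j' k' w) hn hm (continuous_chartMap _ _ _)
    (continuous_chartMap _ _ _) Set.inter_subset_left Set.inter_subset_left
    (hLip hjk.ne z) (hLip hjk'.ne w) (le_max_left _ _) ?_ ?_ hsm fun Θ hΘ => hs hΘ
  · intro x hx y hy
    refine (dist_le_of_admissible (by positivity) (coneRadius_le n) (coneRadius_le_third n) hjk.ne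
      hadm x hx y hy).trans (mul_le_mul_of_nonneg_right ?_ dist_nonneg)
    exact_mod_cast (le_max_left _ _).trans (le_max_right _ _)
  · intro x hx y hy
    refine (dist_le_of_admissible (by positivity) (coneRadius_le m) (coneRadius_le_third m) hjk'.ne
      hadm' x hx y hy).trans (mul_le_mul_of_nonneg_right ?_ dist_nonneg)
    exact_mod_cast (le_max_right _ _).trans (le_max_right _ _)

/-! ### The reduction of estimates -/

theorem weightedTilde_eq {l n m : ℕ} (i : ℕ) (α : Fin 4 → ℝ) (Z' : Triple l n m)
    (G : Triple l n m → ℝ≥0∞) (Θ' : Triple l n m) : weightedTilde i α Z' G Θ' =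
      G Θ' * (radialOne i (α 1) Z'.snd.snd Θ'.snd.snd * angular (α 3) Θ'.snd.snd) *
        (radialOne i (α 0) Z'.snd.fst Θ'.snd.fst * angular (α 2) Θ'.snd.fst) := by
  unfold weightedTilde radialOne
  split_ifs
  · simp only [radialWeight, angularWeight, radial, angular]; ring
  · simp only [angularWeight, angular]; ring

theorem weighted_eq {l n m : ℕ} (α : Fin 4 → ℝ) (Z : Triple l (n + 1) (m + 1))
    (F : Triple l (n + 1) (m + 1) → ℝ≥0∞) (Θ : Triple l (n + 1) (m + 1)) : weighted α Z F Θ =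
      F Θ * (radial (α 1) Z.snd.snd Θ.snd.snd * angular (α 3) Θ.snd.snd) *
        (radial (α 0) Z.snd.fst Θ.snd.fst * angular (α 2) Θ.snd.fst) := by
  simp only [weighted, radialWeight, angularWeight, radial, angular]; ring

theorem exists_lintegral_weighted_le (l : ℕ) {n m : ℕ} (hn : 1 ≤ n) (hm : 1 ≤ m)
    {C₀ C₁ C₂ : ℝ} (hC₀ : 0 < C₀) (hC₁ : 1 < C₁) (hC₂ : 1 < C₂) {α : Fin 4 → ℝ}
    (h0 : 0 ≤ α 0 ∧ α 0 < 2 * n) (h1 : 0 ≤ α 1 ∧ α 1 < 2 * m) (h2 : 0 ≤ α 2 ∧ α 2 < 2)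
    (h3 : 0 ≤ α 3 ∧ α 3 < 2) :
    ∃ A : NNReal, ∀ δ : ℝ, 0 < δ → 18 * δ ≤ C₀ → δ ≤ 1 / 4 → 1 / δ + 1 < C₁ →
      ∀ (P : ChartChoice n C₀ δ) (Q : ChartChoice m C₀ δ) (i : ℕ), (i = 1 ∨ i = 2) →
      ∀ (Z : Triple l (n + 1) (m + 1)) (Z' : Triple l n m), Comparable P Q C₁ Z Z' →
      ∀ (F : Triple l (n + 1) (m + 1) → ℝ≥0∞) (G : Triple l n m → ℝ≥0∞),
      Measurable F → Measurable G →
      (∀ Θ Θ', IComparable P Q C₁ C₂ i Z Z' Θ Θ' → F Θ ≤ G Θ') →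
      ∫⁻ Θ, weighted α Z F Θ ∂dV l n m ≤ A * ∫⁻ Θ', weightedTilde i α Z' G Θ' := by
  have hσn := sigmaFinite_coneMeasure hn
  have hσm := sigmaFinite_coneMeasure hm
  obtain ⟨A, hA⟩ := exists_dV_le l hn hm
  obtain ⟨An, hAn⟩ := exists_factor_estimate hn hC₀ hC₁ hC₂ h0.1 h0.2 h2.1 h2.2
  obtain ⟨Am, hAm⟩ := exists_factor_estimate hm hC₀ hC₁ hC₂ h1.1 h1.2 h3.1 h3.2
  refine ⟨A * (An * Am), fun δ hδ hδC hδ4 hδC₁ P Q i hi Z Z' hZ F G hF hG h => ?_⟩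
  set τ := tripleEquiv l (n + 1) (m + 1)
  set τ' := tripleEquiv l n m
  set W₁ : Cvec (n + 1) → ℝ≥0∞ := fun ζ => radial (α 0) Z.snd.fst ζ * angular (α 2) ζ with hW₁
  set W₂ : Cvec (m + 1) → ℝ≥0∞ := fun η => radial (α 1) Z.snd.snd η * angular (α 3) η with hW₂
  set V₁ : Cvec n → ℝ≥0∞ := fun ζ => radialOne i (α 0) Z'.snd.fst ζ * angular (α 2) ζ with hV₁
  set V₂ : Cvec m → ℝ≥0∞ := fun η => radialOne i (α 1) Z'.snd.snd η * angular (α 3) η with hV₂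
  have mW₁ : Measurable W₁ := (measurable_radial _ _).mul (measurable_angular _)
  have mW₂ : Measurable W₂ := (measurable_radial _ _).mul (measurable_angular _)
  have mV₁ : Measurable V₁ := (measurable_radialOne _ _ _).mul (measurable_angular _)
  have mV₂ : Measurable V₂ := (measurable_radialOne _ _ _).mul (measurable_angular _)
  have hF' : Measurable fun p => F (τ.symm p) := hF.comp τ.symm.measurable
  have hG' : Measurable fun p => G (τ'.symm p) := hG.comp τ'.symm.measurable
  have mF2 : Measurable fun p : Cvec l × Cvec (n + 1) × Cvec (m + 1) =>
      F (τ.symm p) * W₂ p.2.2 := hF'.mul (mW₂.comp measurable_snd.snd)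
  have mF1 : Measurable fun p : Cvec l × Cvec (n + 1) × Cvec (m + 1) =>
      F (τ.symm p) * W₂ p.2.2 * W₁ p.2.1 := mF2.mul (mW₁.comp measurable_snd.fst)
  have mG2 : Measurable fun p : Cvec l × Cvec n × Cvec m =>
      G (τ'.symm p) * V₂ p.2.2 := hG'.mul (mV₂.comp measurable_snd.snd)
  have mG1 : Measurable fun p : Cvec l × Cvec n × Cvec m =>
      G (τ'.symm p) * V₂ p.2.2 * V₁ p.2.1 := mG2.mul (mV₁.comp measurable_snd.fst)
  have hslice : ∀ ξ : Cvec l,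
      ∫⁻ q : Cvec (n + 1) × Cvec (m + 1), F (τ.symm (ξ, q)) * W₂ q.2 * W₁ q.1
        ∂(coneMeasure n).prod (coneMeasure m) ≤
      (An * Am : ℝ≥0∞) * ∫⁻ q : Cvec n × Cvec m, G (τ'.symm (ξ, q)) * V₂ q.2 * V₁ q.1
        ∂volume.prod volume := by
    intro ξ
    have mFξ : Measurable fun q : Cvec (n + 1) × Cvec (m + 1) => F (τ.symm (ξ, q)) * W₂ q.2 :=
      mF2.comp measurable_prodMk_left
    have mGξ : Measurable fun q : Cvec n × Cvec m => G (τ'.symm (ξ, q)) * V₂ q.2 :=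
      mG2.comp measurable_prodMk_left
    have mFξ' : Measurable fun q : Cvec (n + 1) × Cvec (m + 1) =>
        F (τ.symm (ξ, q)) * W₂ q.2 * W₁ q.1 := mFξ.mul (mW₁.comp measurable_fst)
    have mGξ' : Measurable fun q : Cvec n × Cvec m =>
        G (τ'.symm (ξ, q)) * V₂ q.2 * V₁ q.1 := mGξ.mul (mV₁.comp measurable_fst)
    rw [lintegral_prod _ mFξ'.aemeasurable, lintegral_prod _ mGξ'.aemeasurable]
    have e1 : ∀ ζ, ∫⁻ η, F (τ.symm (ξ, ζ, η)) * W₂ η * W₁ ζ ∂coneMeasure m =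
        (∫⁻ η, F (τ.symm (ξ, ζ, η)) * W₂ η ∂coneMeasure m) * W₁ ζ := fun ζ =>
      lintegral_mul_const (f := fun η => F (τ.symm (ξ, ζ, η)) * W₂ η) _
        (mFξ.comp measurable_prodMk_left)
    have e2 : ∀ ζ', ∫⁻ η', G (τ'.symm (ξ, ζ', η')) * V₂ η' * V₁ ζ' =
        (∫⁻ η', G (τ'.symm (ξ, ζ', η')) * V₂ η') * V₁ ζ' := fun ζ' =>
      lintegral_mul_const (f := fun η' => G (τ'.symm (ξ, ζ', η')) * V₂ η') _
        (mGξ.comp measurable_prodMk_left)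
    simp only [e1, e2]
    have mg : Measurable fun ζ' => ∫⁻ η', G (τ'.symm (ξ, ζ', η')) * V₂ η' :=
      mGξ.lintegral_prod_right'
    have key := hAn δ hδ hδC hδ4 hδC₁ P i hi Z.snd.fst Z'.snd.fst hZ.2.1
      (fun ζ => ∫⁻ η, F (τ.symm (ξ, ζ, η)) * W₂ η ∂coneMeasure m)
      (fun ζ' => Am * ∫⁻ η', G (τ'.symm (ξ, ζ', η')) * V₂ η')
      mFξ.lintegral_prod_right' (mg.const_mul _) fun ζ ζ' hζ =>
        hAm δ hδ hδC hδ4 hδC₁ Q i hi Z.snd.snd Z'.snd.snd hZ.2.2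
          (fun η => F (τ.symm (ξ, ζ, η))) (fun η' => G (τ'.symm (ξ, ζ', η')))
          (hF'.comp (measurable_prodMk_left.comp measurable_prodMk_left))
          (hG'.comp (measurable_prodMk_left.comp measurable_prodMk_left))
          fun η η' hη => h _ _ ⟨rfl, hζ, hη⟩
    refine key.trans_eq ?_
    rw [mul_assoc]
    congr 1
    rw [← lintegral_const_mul (f := fun ζ' => (∫⁻ η', G (τ'.symm (ξ, ζ', η')) * V₂ η') * V₁ ζ') _
      (mg.mul mV₁)]
    simp only [mul_assoc, hV₁]
  calc ∫⁻ Θ, weighted α Z F Θ ∂dV l n m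
      ≤ A * ∫⁻ Θ, weighted α Z F Θ ∂(productMeasure l n m).map τ.symm := by
        refine (lintegral_mono' hA le_rfl).trans_eq ?_
        rw [lintegral_smul_measure, smul_eq_mul]
    _ = A * ∫⁻ p, F (τ.symm p) * W₂ p.2.2 * W₁ p.2.1 ∂productMeasure l n m := by
        rw [lintegral_map_equiv]
        congr 1
        refine lintegral_congr fun p => ?_
        rw [weighted_eq]
        rfl
    _ ≤ A * ((An * Am : ℝ≥0∞) * ∫⁻ p, G (τ'.symm p) * V₂ p.2.2 * V₁ p.2.1
          ∂(volume : Measure (Cvec l)).prod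
            ((volume : Measure (Cvec n)).prod (volume : Measure (Cvec m)))) := by
        refine mul_le_mul' le_rfl ?_
        rw [productMeasure, lintegral_prod _ mF1.aemeasurable, lintegral_prod _ mG1.aemeasurable,
          ← lintegral_const_mul _ mG1.lintegral_prod_right']
        exact lintegral_mono fun ξ => hslice ξ
    _ = _ := by
        rw [← (measurePreserving_tripleEquiv l n m).lintegral_comp mG1]
        push_cast
        rw [mul_assoc, mul_assoc, mul_assoc]
        congr 3
        refine lintegral_congr fun Θ' => ?_
        rw [weightedTilde_eq, MeasurableEquiv.symm_apply_apply]
        rfl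

section Norms

variable {n : ℕ} {C₀ δ C₁ C₂ : ℝ} {P : ChartChoice n C₀ δ} {i : ℕ} {z ζ : Cvec (n + 1)}
  {z' ζ' : Cvec n}

theorem CompPoint.norm_le_or (hC₁ : 1 < C₁) (hδ : 0 < δ) (hδC : 1 / δ + 1 < C₁)
    (hz : CompBase P C₁ z z') (h : CompPoint P C₁ C₂ i z z' ζ ζ') :
    ‖ζ'‖ ≤ ‖ζ‖ ∨ (i ≠ 1 ∧ ‖ζ'‖ ≤ Real.sqrt 2 * ‖z‖) := by
  obtain ⟨hc, h1, h2, h3⟩ := h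
  rcases lt_or_ge (Real.sqrt 2 * ‖z‖) ‖ζ‖ with hf | hf
  · exact Or.inl (h1 hf).le
  rcases lt_or_ge ‖ζ - z‖ (‖z‖ / C₁) with hn | hn
  · left
    rw [h2 hn]
    exact norm_chartMap_le (P.lt_of_mem z (mem_chartDomain_of_near hC₁ hδ hδC hc hn)).ne z ζ
  · obtain ⟨h4, -, h5⟩ := h3 ⟨hf, hn⟩
    by_cases hi : i = 1
    · exact Or.inl (h5 hi)
    · rw [hz.norm_eq] at h4
      exact Or.inr ⟨hi, h4⟩

theorem CompPoint.norm_sq_le (hC₁ : 1 < C₁) (hδ : 0 < δ) (hδC : 1 / δ + 1 < C₁)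
    (hz : CompBase P C₁ z z') (h : CompPoint P C₁ C₂ i z z' ζ ζ') :
    ‖ζ'‖ ^ 2 ≤ ‖ζ‖ ^ 2 + (if i = 1 then 0 else 2) * ‖z‖ ^ 2 := by
  rcases h.norm_le_or hC₁ hδ hδC hz with h | ⟨hi, h⟩
  · have h1 := pow_le_pow_left₀ (norm_nonneg _) h 2
    have h2 : 0 ≤ (if i = 1 then (0 : ℝ) else 2) * ‖z‖ ^ 2 := by
      split_ifs <;> positivity
    linarith
  · have h1 := pow_le_pow_left₀ (norm_nonneg _) h 2
    rw [mul_pow, Real.sq_sqrt (by norm_num)] at h1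
    rw [if_neg hi]
    nlinarith [sq_nonneg ‖ζ‖]

end Norms

theorem norm_sq_triple {a b c : ℕ} (Θ : Triple a b c) :
    ‖Θ‖ ^ 2 = ‖Θ.fst‖ ^ 2 + ‖Θ.snd.fst‖ ^ 2 + ‖Θ.snd.snd‖ ^ 2 := by
  have := dist_sq_triple Θ 0
  simpa only [dist_zero_right, WithLp.zero_fst, WithLp.zero_snd] using this

theorem IComparable.mem_ball {l n m : ℕ} {C₀ δ C₁ C₂ : ℝ} {P : ChartChoice n C₀ δ}
    {Q : ChartChoice m C₀ δ} {i : ℕ} (hi : i = 1 ∨ i = 2) (hC₁ : 1 < C₁) (hδ : 0 < δ)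
    (hδC : 1 / δ + 1 < C₁) {Z Θ : Triple l (n + 1) (m + 1)} {Z' Θ' : Triple l n m}
    (hZ : Z ∈ Metric.ball (0 : Triple l (n + 1) (m + 1)) 1) (hZZ' : Comparable P Q C₁ Z Z')
    (hΘ : Θ ∈ Metric.ball (0 : Triple l (n + 1) (m + 1)) 1)
    (h : IComparable P Q C₁ C₂ i Z Z' Θ Θ') : Θ' ∈ Metric.ball (0 : Triple l n m) (i : ℝ) := by
  rw [mem_ball_zero_iff] at hZ hΘ ⊢
  have h1 := h.2.1.norm_sq_le hC₁ hδ hδC hZZ'.2.1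
  have h2 := h.2.2.norm_sq_le hC₁ hδ hδC hZZ'.2.2
  have hZ2 := norm_sq_triple Z
  have hΘ2 := norm_sq_triple Θ
  have hΘ'2 := norm_sq_triple Θ'
  rw [← h.1] at hΘ'2
  have hZ1 : ‖Z‖ ^ 2 < 1 := by nlinarith [norm_nonneg Z]
  have hΘ1 : ‖Θ‖ ^ 2 < 1 := by nlinarith [norm_nonneg Θ]
  refine lt_of_pow_lt_pow_left₀ 2 (by positivity) ?_
  rcases hi with rfl | rfl
  · simp only [if_true] at h1 h2
    push_cast
    linarith
  · simp only [OfNat.ofNat_ne_one, if_false] at h1 h2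
    push_cast
    nlinarith [sq_nonneg ‖Z.fst‖]

theorem measurableSet_manifoldM (l n m : ℕ) : MeasurableSet (manifoldM l n m) := by
  have h := (tripleEquiv l (n + 1) (m + 1)).measurable
  exact ((h.snd.fst (measurableSet_cone n)).inter (h.snd.snd (measurableSet_cone m))).inter
    Metric.isOpen_ball.measurableSet

end ReductionOfEstimates

end

open ReductionOfEstimates
theorem theorem5p6 (l n m : ℕ) (hl : 1 ≤ l) (hn : 2 ≤ n) (hm : 2 ≤ m) (C₀ : ℝ) (hC₀ : 0 < C₀) :
    ∃ δ₀ : ℝ, 0 < δ₀ ∧ ∀ (C₁ C₂ C : ℝ), 1 < C₁ → 1 < C₂ → 0 < C →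
    ∀ α : Fin 4 → ℝ, (0 ≤ α 0 ∧ α 0 < 2 * n) → (0 ≤ α 1 ∧ α 1 < 2 * m) →
      (0 ≤ α 2 ∧ α 2 < 2) → (0 ≤ α 3 ∧ α 3 < 2) →
    ∃ C₄ : ℝ, 0 < C₄ ∧
    ∀ δ : ℝ, 0 < δ → δ < δ₀ → 1 / δ + 1 < C₁ →
    ∀ (P : ChartChoice n C₀ δ) (Q : ChartChoice m C₀ δ) (i : ℕ), (i = 1 ∨ i = 2) →
    ∀ Z ∈ Metric.ball (0 : Triple l (n + 1) (m + 1)) 1,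
    ∀ Z' ∈ Metric.ball (0 : Triple l n m) 1, Comparable P Q C₁ Z Z' →
    ∀ K L : Triple l (n + 1) (m + 1) → ℝ≥0∞, Measurable K → Measurable L →
    ∀ K' L' : Triple l n m → ℝ≥0∞, Measurable K' → Measurable L' →
    LesssimLeft P Q C₁ C₂ i Z Z' C K K' →
    LesssimLeft P Q C₁ C₂ i Z Z' C L L' → LesssimRight P Q C₁ C₂ i Z Z' C L L' →
    (∫⁻ Θ in manifoldM l n m, weighted α Z K Θ ∂(dV l n m) ≤
      ENNReal.ofReal C₄ *
        ∫⁻ Θ' in Metric.ball (0 : Triple l n m) (i : ℝ), weightedTilde i α Z' K' Θ') ∧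
    (∀ ε : ℝ, 0 < ε →
      ∫⁻ Θ in {Θ | Θ ∈ manifoldM l n m ∧ L Θ ≤ ENNReal.ofReal ε}, weighted α Z K Θ ∂(dV l n m) ≤
      ENNReal.ofReal C₄ *
        ∫⁻ Θ' in {Θ' | Θ' ∈ Metric.ball (0 : Triple l n m) (i : ℝ) ∧
            L' Θ' ≤ ENNReal.ofReal (C₄ * ε)}, weightedTilde i α Z' K' Θ') ∧
    (∀ ε₁ ε₂ : ℝ, 0 < ε₁ → ε₁ < ε₂ →
      ∫⁻ Θ in {Θ | Θ ∈ manifoldM l n m ∧ ENNReal.ofReal ε₁ ≤ L Θ ∧ L Θ ≤ ENNReal.ofReal ε₂},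
        weighted α Z K Θ ∂(dV l n m) ≤
      ENNReal.ofReal C₄ *
        ∫⁻ Θ' in {Θ' | Θ' ∈ Metric.ball (0 : Triple l n m) (i : ℝ) ∧
            ENNReal.ofReal (ε₁ / C₄) ≤ L' Θ' ∧ L' Θ' ≤ ENNReal.ofReal (C₄ * ε₂)},
          weightedTilde i α Z' K' Θ') := by
  refine ⟨min (1 / 4) (C₀ / 18), by positivity, ?_⟩
  intro C₁ C₂ C hC₁ hC₂ hC α h0 h1 h2 h3
  obtain ⟨A, hA⟩ := exists_lintegral_weighted_le l (by omega : 1 ≤ n) (by omega : 1 ≤ m)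
    hC₀ hC₁ hC₂ h0 h1 h2 h3
  set C₄ : ℝ := max C (A * C) with hC₄
  have hC₄C : C ≤ C₄ := le_max_left _ _
  have hC₄0 : 0 < C₄ := hC.trans_le hC₄C
  refine ⟨C₄, hC₄0, ?_⟩
  intro δ hδ hδ₀ hδC₁ P Q i hi Z hZ Z' _ hZZ' K L hK hL K' L' hK' hL' hKK' hLL' hL'L
  have hδ4 : δ ≤ 1 / 4 := hδ₀.le.trans (min_le_left _ _)
  have hδC : 18 * δ ≤ C₀ := by
    have := hδ₀.le.trans (min_le_right _ _)
    linarith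
  have key : ∀ (S : Set (Triple l (n + 1) (m + 1))) (S' : Set (Triple l n m)), MeasurableSet S →
      MeasurableSet S' → S ⊆ manifoldM l n m →
      (∀ Θ ∈ S, ∀ Θ', Θ' ∈ Metric.ball (0 : Triple l n m) (i : ℝ) →
        L Θ ≤ ENNReal.ofReal C * L' Θ' → L' Θ' ≤ ENNReal.ofReal C * L Θ → Θ' ∈ S') →
      ∫⁻ Θ in S, weighted α Z K Θ ∂(dV l n m) ≤
        ENNReal.ofReal C₄ * ∫⁻ Θ' in S', weightedTilde i α Z' K' Θ' := by
    intro S S' hS hS' hSM hSS'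
    have hmain := hA δ hδ hδC hδ4 hδC₁ P Q i hi Z Z' hZZ' (S.indicator K)
      (S'.indicator fun Θ' => ENNReal.ofReal C * K' Θ') (hK.indicator hS)
      ((hK'.const_mul _).indicator hS') ?_
    · rw [← lintegral_indicator hS, ← lintegral_indicator hS']
      have e1 : ∀ Θ, S.indicator (weighted α Z K) Θ = weighted α Z (S.indicator K) Θ := by
        intro Θ
        by_cases hΘ : Θ ∈ S <;> simp [weighted, hΘ]
      have e2 : ∀ Θ', weightedTilde i α Z' (S'.indicator fun Θ' => ENNReal.ofReal C * K' Θ') Θ' =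
          ENNReal.ofReal C * S'.indicator (weightedTilde i α Z' K') Θ' := by
        intro Θ'
        by_cases hΘ' : Θ' ∈ S'
        · simp only [weightedTilde_eq, Set.indicator_of_mem hΘ', mul_assoc]
        · simp only [weightedTilde_eq, Set.indicator_of_notMem hΘ', zero_mul, mul_zero]
      simp only [e1]
      refine hmain.trans ?_
      simp only [e2]
      rw [lintegral_const_mul' _ _ ENNReal.ofReal_ne_top, ← mul_assoc]
      refine mul_le_mul' ?_ le_rfl
      rw [← ENNReal.ofReal_coe_nnreal, ← ENNReal.ofReal_mul A.coe_nonneg]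
      exact ENNReal.ofReal_le_ofReal (le_max_right _ _)
    · intro Θ Θ' hcomp
      refine Set.indicator_apply_le' (fun hΘ => ?_) fun _ => zero_le
      have hM := hSM hΘ
      have hb := hcomp.mem_ball hi hC₁ hδ hδC₁ hZ hZZ' hM.2
      have hM' := subset_closure hM
      have hb' := Metric.ball_subset_closedBall hb
      rw [Set.indicator_of_mem (hSS' Θ hΘ Θ' hb (hLL' Θ hM' Θ' hb' hcomp)
        (hL'L Θ hM' Θ' hb' hcomp))]
      exact hKK' Θ hM' Θ' hb' hcomp
  have hMm := measurableSet_manifoldM l n m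
  have hBm : MeasurableSet (Metric.ball (0 : Triple l n m) (i : ℝ)) :=
    Metric.isOpen_ball.measurableSet
  have hupper : ∀ ε : ℝ, 0 < ε → ∀ Θ Θ', L Θ ≤ ENNReal.ofReal ε → L' Θ' ≤ ENNReal.ofReal C * L Θ →
      L' Θ' ≤ ENNReal.ofReal (C₄ * ε) := by
    intro ε hε Θ Θ' h4 h5
    refine h5.trans ((mul_le_mul' le_rfl h4).trans ?_)
    rw [← ENNReal.ofReal_mul hC.le]
    exact ENNReal.ofReal_le_ofReal (by nlinarith)
  refine ⟨?_, ?_, ?_⟩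
  · exact key _ _ hMm hBm subset_rfl fun Θ _ Θ' hb _ _ => hb
  · intro ε hε
    refine key _ _ (hMm.inter (measurableSet_le hL measurable_const))
      (hBm.inter (measurableSet_le hL' measurable_const)) (fun Θ hΘ => hΘ.1) ?_
    exact fun Θ hΘ Θ' hb _ h5 => ⟨hb, hupper ε hε Θ Θ' hΘ.2 h5⟩
  · intro ε₁ ε₂ hε₁ hε
    refine key _ _ (hMm.inter ((measurableSet_le measurable_const hL).inter
        (measurableSet_le hL measurable_const)))
      (hBm.inter ((measurableSet_le measurable_const hL').inter
        (measurableSet_le hL' measurable_const))) (fun Θ hΘ => hΘ.1) ?_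
    refine fun Θ hΘ Θ' hb h4 h5 => ⟨hb, ?_, hupper ε₂ (hε₁.trans hε) Θ Θ' hΘ.2.2 h5⟩
    have h6 := hΘ.2.1.trans h4
    calc ENNReal.ofReal (ε₁ / C₄) ≤ ENNReal.ofReal (ε₁ / C) :=
          ENNReal.ofReal_le_ofReal (div_le_div_of_nonneg_left hε₁.le hC hC₄C)
      _ = ENNReal.ofReal ε₁ / ENNReal.ofReal C := ENNReal.ofReal_div_of_pos hC
      _ ≤ L' Θ' := ENNReal.div_le_of_le_mul (by rwa [mul_comm])
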